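/- **Theorem 3.3.** Let $\mathbb X=L^2(0,\pi)$ (real-valued), let $1\le r<\infty$, and let $g:\mathbb R_+\times\mathbb R\to\mathbb R$ be measurable in $t$ for each fixed $y$ and Lipschitz continuous in $y$ uniformly in $t\ge 0$, with $g(\cdot,0)\in L^r(\mathbb R_+)$. Put $G(t,v)=g(t,v(\cdot))$ for $v\in\mathbb X$, and let $\Delta v=v''$ with domain $\{v\in W^{2,2}(0,\pi): v'(0)=v'(\pi)=0\}$. Then $\Delta$ generates the strongly continuous semigroup $T(t)f=\sum_{n\ge 0}e^{-n^2t}\langle e_n,f\rangle e_n$ on $\mathbb X$, where $e_0=\sqrt{1/\pi}$ and $e_n(x)=\sqrt{2/\pi}\cos(nx)$ for $n\ge1$. Call a continuous function $u:[s,\infty)\to\mathbb X$ ($s\ge 0$) a mild solution of $$u'(t)=\Delta u(t)+G(t,u(t))\qquad(*)$$ starting from $x\in\mathbb X$ at time $s$ if $$u(t)=T(t-s)x+\int_s^tT(t-\xi)\,G(\xi,u(\xi))\,d\xi\qquad\text{for all }t\ge s .$$ Equation $(*)$ generates a continuous evolution family $\{X(t,s)\}_{t\ge s\ge0}$ on $\mathbb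 X$. That is: for all $s\ge0$ and $x\in\mathbb X$, the map $t\mapsto X(t,s)x$ is the unique mild solution starting from $x$ at time $s$; $X(t,t)x=x$ and $X(t,s)=X(t,\rho)\circ X(\rho,s)$ for $t\ge\rho\ge s\ge0$; there are $M,\omega>0$ with $\|X(t,s)x-X(t,s)y\|\le Me^{\omega(t-s)}\|x-y\|$ for all $t\ge s\ge 0$ and $x,y\in\mathbb X$; and $X(t,s)x$ is jointly continuous in $(t,s,x)$. Let $p,q\in[1,\infty]$ with $(p,q)\ne(1,\infty)$, and assume that the pair $(L^p(\mathbb R_+,\mathbb X),L^q(\mathbb R_+,\mathbb X))$ is admissible to $\{X(t,s)\}$: with $(\mathbb Gf)(t)=\int_0^tX(t,s)f(s)\,ds$, one has $\mathbb Gf\in L^q(\mathbb R_+,\mathbb X)$ for every $f\in L^p(\mathbb R_+,\mathbb X)$, and there is $K>0$ with $\|\mathbb Gf_1-\mathbb Gf_2\|_q\le K\|f_1-f_2\|_p$ for all $f_1,f_2\in L^p(\mathbb R_+,\mathbb X)$. Then there is a mild solution $u\in L^r(\mathbb R_+,\mathbb X)$ of $(*)$ on $[0,\infty)$ that attracts all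 other mild solutions at an exponential rate: there are $N,\alpha>0$ such that, for every $s\ge0$, every $x\in\mathbb X$ and every mild solution $v$ of $(*)$ on $[s,\infty)$ starting from $x$ at time $s$, $$\|v(t)-u(t)\|\le Ne^{-\alpha(t-s)}\,\|x-u(s)\|\qquad\text{for all }t\ge s .$$ -/

import Mathlib

open MeasureTheory Set Filter Topology
open scoped ENNReal NNReal

noncomputable section

namespace NeumannHeat

/-! ### The state space `L²(0, π)` and the Neumann Laplacian -/

/-- Lebesgue measure on the interval `(0, π)`. -/
abbrev spaceMeasure : Measure ℝ := volume.restrict (Ioo 0 Real.pi)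

/-- Lebesgue measure on the half-line `ℝ₊ = [0, ∞)`. -/
abbrev timeMeasure : Measure ℝ := volume.restrict (Ici 0)

/-- The real Hilbert space `L²(0, π)`. -/
abbrev StateSpace : Type := Lp ℝ 2 spaceMeasure

/-- The graph of the Neumann Laplacian in `L²(0, π)`: `f` has a `C¹` representative `v` on
`[0, π]` whose derivative `w` is absolutely continuous (so `v ∈ W^{2,2}(0, π)` as soon as
`w' ∈ L²`), `w` vanishes at both end points, and `w' = h` almost everywhere. -/
def NeumannLaplacian (f h : StateSpace) : Prop :=
  ∃ v w : ℝ → ℝ,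
    (∀ᵐ x ∂spaceMeasure, f x = v x) ∧
    (∀ x ∈ Icc 0 Real.pi, HasDerivWithinAt v (w x) (Icc 0 Real.pi) x) ∧
    AbsolutelyContinuousOnInterval w 0 Real.pi ∧
    (∀ᵐ x ∂spaceMeasure, HasDerivAt w (h x) x) ∧
    w 0 = 0 ∧ w Real.pi = 0

/-- The `L²(0, π)`-normalized eigenfunctions of the Neumann Laplacian: `√(1/π)` for `n = 0`,
and `√(2/π) cos (n x)` for `n ≥ 1`. -/
def cosFun (n : ℕ) (x : ℝ) : ℝ :=
  if n = 0 then √(1 / Real.pi) else √(2 / Real.pi) * Real.cos (n * x)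

theorem memLp_cosFun (n : ℕ) : MemLp (cosFun n) 2 spaceMeasure := by
  have hc : Continuous (cosFun n) := by
    unfold cosFun
    split_ifs <;> fun_prop
  refine MemLp.of_bound hc.aestronglyMeasurable (√(1 / Real.pi) + √(2 / Real.pi))
    (Eventually.of_forall fun x => ?_)
  have h1 := Real.sqrt_nonneg (1 / Real.pi)
  have h2 := Real.sqrt_nonneg (2 / Real.pi)
  unfold cosFun
  split_ifs
  · rw [Real.norm_of_nonneg h1]; linarith
  · rw [norm_mul, Real.norm_of_nonneg h2, Real.norm_eq_abs]
    nlinarith [Real.abs_cos_le_one (n * x)]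

/-- `cosFun n` as an element of `L²(0, π)`. -/
def cosMode (n : ℕ) : StateSpace := (memLp_cosFun n).toLp (cosFun n)

/-- The Neumann heat semigroup `T(t)` on `L²(0, π)`, `t ≥ 0`:
`T(t) f = ∑ₙ e^{-n² t} ⟨eₙ, f⟩ eₙ`. -/
def heat (t : ℝ) (f : StateSpace) : StateSpace :=
  ∑' n : ℕ, (Real.exp (-((n : ℝ) ^ 2 * t)) * inner ℝ (cosMode n) f) • cosMode n

/-- `T` is a strongly continuous semigroup of bounded linear operators. -/
structure IsC0Semigroup (T : ℝ → StateSpace → StateSpace) : Prop where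
  bounded_linear : ∀ t, 0 ≤ t → IsBoundedLinearMap ℝ (T t)
  zero : ∀ f, T 0 f = f
  add : ∀ s t, 0 ≤ s → 0 ≤ t → ∀ f, T (s + t) f = T s (T t f)
  strongly_continuous : ∀ f, ContinuousOn (fun t => T t f) (Ici 0)

/-- The infinitesimal generator of `T` is the operator with graph `A`: `(f, h) ∈ A` if and only if
`(T(t) f - f) / t → h` as `t ↓ 0`. -/
def HasGenerator (T : ℝ → StateSpace → StateSpace) (A : StateSpace → StateSpace → Prop) : Prop :=
  ∀ f h, A f h ↔ Tendsto (fun t : ℝ => t⁻¹ • (T t f - f)) (𝓝[>] 0) (𝓝 h)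

/-! ### The semilinear equation -/

open scoped Classical in
/-- The superposition operator `G(t, v) = g(t, v(·))` on `L²(0, π)`. When `g(t, ·)` is Lipschitz
continuous the function `g(t, v(·))` always lies in `L²(0, π)` (see `memLp_superposition`), so the
default value `0` is never taken. -/
def superposition (g : ℝ → ℝ → ℝ) (t : ℝ) (v : StateSpace) : StateSpace :=
  if h : MemLp (fun x => g t (v x)) 2 spaceMeasure then h.toLp _ else 0

theorem memLp_superposition {g : ℝ → ℝ → ℝ} {t : ℝ} {L : ℝ≥0} (hL : LipschitzWith L (g t))
    (v : StateSpace) : MemLp (fun x => g t (v x)) 2 spaceMeasure := by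
  have h1 : MemLp ((fun y => g t y - g t 0) ∘ (v : ℝ → ℝ)) 2 spaceMeasure := by
    refine LipschitzWith.comp_memLp (K := L) ?_ (by simp) (Lp.memLp v)
    intro x y
    simpa [edist_dist, dist_eq_norm] using hL x y
  have h2 : MemLp (fun _ : ℝ => g t 0) 2 spaceMeasure := memLp_const _
  convert h1.add h2 using 1
  funext x
  simp

/-- `v : [s, ∞) → L²(0, π)` is a (global) mild solution of `u' = Δu + G(t, u)` starting from `x`
at time `s`: it is continuous and
`v(t) = T(t - s) x + ∫ₛᵗ T(t - ξ) G(ξ, v(ξ)) dξ` for all `t ≥ s`.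
Values of `v` before time `s` are irrelevant. -/
def IsMildSolution (g : ℝ → ℝ → ℝ) (s : ℝ) (x : StateSpace) (v : ℝ → StateSpace) : Prop :=
  ContinuousOn v (Ici s) ∧
    ∀ t, s ≤ t → v t = heat (t - s) x + ∫ ξ in s..t, heat (t - ξ) (superposition g ξ (v ξ))

/-! ### Evolution families and admissibility

A family `X(t, s)`, `t ≥ s ≥ 0`, is represented by `X : ℝ → ℝ → StateSpace → StateSpace`, of which
only the values with `0 ≤ s ≤ t` matter. -/

/-- Continuous (nonlinear) evolution families. -/
structure IsContinuousEvolutionFamily (X : ℝ → ℝ → StateSpace → StateSpace) : Prop where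
  self : ∀ t, 0 ≤ t → ∀ x, X t t x = x
  comp : ∀ t r s, 0 ≤ s → s ≤ r → r ≤ t → ∀ x, X t s x = X t r (X r s x)
  lipschitz : ∃ M > 0, ∃ ω > 0, ∀ t s, 0 ≤ s → s ≤ t → ∀ x y,
    ‖X t s x - X t s y‖ ≤ M * Real.exp (ω * (t - s)) * ‖x - y‖
  continuous : ContinuousOn (fun z : ℝ × ℝ × StateSpace => X z.1 z.2.1 z.2.2)
    {z | 0 ≤ z.2.1 ∧ z.2.1 ≤ z.1}

/-- The equation `u' = Δu + G(t, u)` generates `X`: for all `s ≥ 0` and all `x` the map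
`t ↦ X(t, s) x` is the unique mild solution starting from `x` at time `s`. -/
def Generates (g : ℝ → ℝ → ℝ) (X : ℝ → ℝ → StateSpace → StateSpace) : Prop :=
  ∀ s, 0 ≤ s → ∀ x, IsMildSolution g s x (fun t => X t s x) ∧
    ∀ v, IsMildSolution g s x v → ∀ t, s ≤ t → v t = X t s x

/-- The Green operator `(𝔾f)(t) = ∫₀ᵗ X(t, s) f(s) ds`. -/
def green (X : ℝ → ℝ → StateSpace → StateSpace) (f : ℝ → StateSpace) (t : ℝ) : StateSpace :=
  ∫ s in (0 : ℝ)..t, X t s (f s)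

/-- The pair `(L^p(ℝ₊), L^q(ℝ₊))` (functions with values in `L²(0, π)`) is admissible to `X`:
the Green operator maps `L^p` to `L^q` and is Lipschitz continuous between these spaces. -/
def Admissible (p q : ℝ≥0∞) (X : ℝ → ℝ → StateSpace → StateSpace) : Prop :=
  (∀ f, MemLp f p timeMeasure → MemLp (green X f) q timeMeasure) ∧
    ∃ K : ℝ≥0, 0 < K ∧ ∀ f₁ f₂, MemLp f₁ p timeMeasure → MemLp f₂ p timeMeasure →
      eLpNorm (green X f₁ - green X f₂) q timeMeasure ≤ K * eLpNorm (f₁ - f₂) p timeMeasure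

end NeumannHeat

end

/-! The cosines form a Hilbert basis of `L²(0, π)` (`cosBasis`), so `heat t` is diagonal with
multipliers `e^{-n² t}`. Contractivity, the semigroup law, strong continuity and the generator thus
become scalar statements for each coefficient, reassembled by dominated convergence
(`tendsto_of_inner`). In `hasGenerator_heat` the condition on the coefficients is matched with the
differential operator: integration by parts in one direction, two integrations of `h` in the other.

A Lipschitz `g` induces a globally Lipschitz forcing on `L²`. Picard iteration in an exponentially
weighted norm gives global mild solutions (`exists_isMild`); Grönwall's inequality gives uniqueness,
the exponential Lipschitz bound and, with the semigroup's strong continuity, joint continuity of the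
flow.

Stability comes from testing admissibility on orbits cut off to a window `[s, s + T]`. Inside the
window the evolution law turns the Green integrand into the constant `X(t, s) x`; outside it is
`X(t, ξ) 0` whatever `x` is. After the window, the Green images for `x` and `y` therefore differ by
`T • (X(t, s) x - X(t, s) y)` (`green_windowForcing_sub`). Comparing `L^q` and `L^p` norms
(`window_estimate`) first bounds the Lipschitz constants uniformly, and then bounds them by a
multiple of `T ^ (1/p - 1 - 1/q)`. For `p, q ≥ 1` this exponent is negative exactly when `(p, q) ≠
(1, ∞)`, so a long step is a strict contraction, and iteration gives exponential decay.

The attracting solution is the orbit of `0` from time `0`. Contraction over a step `R`, with a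
Grönwall bound for the flow restarted at `0`, gives a recursion with perturbation `∫ ‖F ξ 0‖`, which
lies in `L^r` after integration of `r`-th powers (`memLp_of_contracting`). Attraction is the
stability estimate applied to `X(t, s) x` and `X(t, s) (u s)`. -/

namespace NeumannHeat

/-! ### Orthonormality and completeness of the cosine system -/

open Polynomial.Chebyshev in
theorem integral_cos_mul_cos (n m : ℕ) :
    ∫ x in (0 : ℝ)..Real.pi, Real.cos (n * x) * Real.cos (m * x) =
      if n = m then (if n = 0 then Real.pi else Real.pi / 2) else 0 := by
  have key : ∫ x in (0 : ℝ)..Real.pi, Real.cos (n * x) * Real.cos (m * x) =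
      ∫ x, (T ℝ (n : ℤ)).eval x * (T ℝ (m : ℤ)).eval x ∂measureT := by
    rw [integral_measureT_eq_integral_cos]
    simp [T_real_cos]
  rw [key]
  split_ifs with h h0
  · subst h; subst h0
    exact integral_eval_T_real_mul_self_measureT_zero
  · subst h
    exact integral_T_real_mul_self_measureT_of_ne_zero h0
  · exact integral_eval_T_real_mul_eval_T_real_measureT_of_ne h

/-- The normalizing constant of `cosFun n`. -/
noncomputable def cosNorm (n : ℕ) : ℝ := if n = 0 then √(1 / Real.pi) else √(2 / Real.pi)

theorem cosNorm_ne_zero (n : ℕ) : cosNorm n ≠ 0 := by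
  have := Real.pi_pos
  unfold cosNorm
  split_ifs <;> positivity

theorem cosFun_eq (n : ℕ) (x : ℝ) : cosFun n x = cosNorm n * Real.cos (n * x) := by
  unfold cosFun cosNorm
  split_ifs with h
  · simp [h]
  · rfl

theorem integral_spaceMeasure (f : ℝ → ℝ) :
    ∫ x, f x ∂spaceMeasure = ∫ x in (0 : ℝ)..Real.pi, f x := by
  rw [intervalIntegral.integral_of_le Real.pi_pos.le, integral_Ioc_eq_integral_Ioo]

theorem inner_cosMode (n : ℕ) (f : StateSpace) :
    inner ℝ (cosMode n) f = cosNorm n * ∫ x in (0 : ℝ)..Real.pi, Real.cos (n * x) * f x := by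
  rw [L2.inner_def, ← intervalIntegral.integral_const_mul, ← integral_spaceMeasure]
  refine integral_congr_ae ?_
  filter_upwards [(memLp_cosFun n).coeFn_toLp] with x hx
  simp only [cosMode, hx, cosFun_eq, RCLike.inner_apply, conj_trivial]
  ring

theorem orthonormal_cosMode : Orthonormal ℝ cosMode := by
  rw [orthonormal_iff_ite]
  intro n m
  have h : ∫ x in (0 : ℝ)..Real.pi, Real.cos (n * x) * cosMode m x =
      cosNorm m * ∫ x in (0 : ℝ)..Real.pi, Real.cos (n * x) * Real.cos (m * x) := by
    rw [← intervalIntegral.integral_const_mul, ← integral_spaceMeasure, ← integral_spaceMeasure]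
    refine integral_congr_ae ?_
    filter_upwards [(memLp_cosFun m).coeFn_toLp] with x hx
    simp only [cosMode, hx, cosFun_eq]
    ring
  rw [inner_cosMode, h, integral_cos_mul_cos]
  have := Real.pi_pos
  split_ifs with h h0
  · subst h; subst h0
    rw [← mul_assoc, ← sq, cosNorm, if_pos rfl, Real.sq_sqrt (by positivity)]
    field_simp
  · subst h
    rw [← mul_assoc, ← sq, cosNorm, if_neg h0, Real.sq_sqrt (by positivity)]
    field_simp
  · simp

theorem intervalIntegrable_coe (f : StateSpace) : IntervalIntegrable f volume 0 Real.pi := by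
  rw [intervalIntegrable_iff_integrableOn_Ioo_of_le Real.pi_pos.le]
  exact (Lp.memLp f).integrable (by norm_num)

/-- The product-to-sum formula trades one factor `cos x` for the frequencies `n ± 1`. Integer
frequencies keep the induction closed, since `n - 1` may be negative; evenness of the cosine returns
to the hypothesis at `k = 0`. -/
theorem integral_cos_pow_mul_eq_zero {f : ℝ → ℝ} (hf : IntervalIntegrable f volume 0 Real.pi)
    (h : ∀ n : ℕ, ∫ x in (0 : ℝ)..Real.pi, Real.cos (n * x) * f x = 0) (k : ℕ) :
    ∀ n : ℤ, ∫ x in (0 : ℝ)..Real.pi, Real.cos x ^ k * Real.cos (n * x) * f x = 0 := by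
  induction k with
  | zero =>
    intro n
    have h1 : ∀ x : ℝ, Real.cos ((n : ℝ) * x) = Real.cos ((n.natAbs : ℝ) * x) := by
      intro x
      rcases Int.natAbs_eq n with hn | hn
      · conv_lhs => rw [hn]
        simp
      · conv_lhs => rw [hn]
        simp
    simp_rw [h1]
    simpa using h n.natAbs
  | succ k ih =>
    intro n
    have h1 : ∀ x : ℝ, Real.cos x ^ (k + 1) * Real.cos (n * x) * f x =
        2⁻¹ * (Real.cos x ^ k * Real.cos ((n + 1 : ℤ) * x) * f x) +
        2⁻¹ * (Real.cos x ^ k * Real.cos ((n - 1 : ℤ) * x) * f x) := by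
      intro x
      push_cast
      rw [add_mul, sub_mul, one_mul, Real.cos_add, Real.cos_sub]
      ring
    simp_rw [h1]
    rw [intervalIntegral.integral_add, intervalIntegral.integral_const_mul,
      intervalIntegral.integral_const_mul, ih, ih]
    · simp
    all_goals
      refine (hf.continuousOn_mul ?_).const_mul _
      fun_prop

theorem integral_eval_cos_mul_eq_zero {f : ℝ → ℝ} (hf : IntervalIntegrable f volume 0 Real.pi)
    (h : ∀ n : ℕ, ∫ x in (0 : ℝ)..Real.pi, Real.cos (n * x) * f x = 0) (P : Polynomial ℝ) :
    ∫ x in (0 : ℝ)..Real.pi, P.eval (Real.cos x) * f x = 0 := by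
  simp_rw [Polynomial.eval_eq_sum_range, Finset.sum_mul]
  rw [intervalIntegral.integral_finsetSum]
  · refine Finset.sum_eq_zero fun k _ => ?_
    simp_rw [mul_assoc]
    rw [intervalIntegral.integral_const_mul]
    have := integral_cos_pow_mul_eq_zero hf h k 0
    simp only [Int.cast_zero, zero_mul, Real.cos_zero, mul_one] at this
    simp [this]
  · intro k _
    refine hf.continuousOn_mul ?_
    fun_prop

/-- On `[0, π]` one has `φ x = (φ ∘ arccos) (cos x)`, so Weierstrass approximation on `[-1, 1]`
makes `φ` a uniform limit of polynomials in `cos x`, against which `f` already integrates to zero.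
-/
theorem integral_continuous_mul_eq_zero {f : ℝ → ℝ} (hf : IntervalIntegrable f volume 0 Real.pi)
    (h : ∀ n : ℕ, ∫ x in (0 : ℝ)..Real.pi, Real.cos (n * x) * f x = 0) {φ : ℝ → ℝ}
    (hφ : Continuous φ) : ∫ x in (0 : ℝ)..Real.pi, φ x * f x = 0 := by
  rw [← norm_le_zero_iff]
  set C := ∫ x in (0 : ℝ)..Real.pi, ‖f x‖ with hC
  have hC0 : 0 ≤ C := intervalIntegral.integral_nonneg Real.pi_pos.le fun x _ => norm_nonneg _
  refine le_of_forall_pos_le_add fun ε hε => ?_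
  obtain ⟨P, hP⟩ := exists_polynomial_near_of_continuousOn (-1) 1 (φ ∘ Real.arccos)
    (hφ.comp Real.continuous_arccos).continuousOn (ε / (C + 1)) (by positivity)
  have hint : IntervalIntegrable (fun x => P.eval (Real.cos x) * f x) volume 0 Real.pi :=
    hf.continuousOn_mul (by fun_prop)
  have hint' : IntervalIntegrable (fun x => φ x * f x) volume 0 Real.pi :=
    hf.continuousOn_mul hφ.continuousOn
  have h1 : ∫ x in (0 : ℝ)..Real.pi, φ x * f x =
      ∫ x in (0 : ℝ)..Real.pi, (φ x * f x - P.eval (Real.cos x) * f x) := by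
    rw [intervalIntegral.integral_sub hint' hint, integral_eval_cos_mul_eq_zero hf h, sub_zero]
  rw [h1]
  calc ‖∫ x in (0 : ℝ)..Real.pi, (φ x * f x - P.eval (Real.cos x) * f x)‖
      ≤ ∫ x in (0 : ℝ)..Real.pi, ε / (C + 1) * ‖f x‖ := by
        refine intervalIntegral.norm_integral_le_of_norm_le Real.pi_pos.le ?_
          (hf.norm.const_mul _)
        refine Eventually.of_forall fun x hx => ?_
        rw [← sub_mul, norm_mul]
        refine mul_le_mul_of_nonneg_right ?_ (norm_nonneg _)
        have := hP (Real.cos x) ⟨Real.neg_one_le_cos x, Real.cos_le_one x⟩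
        rw [Function.comp, Real.arccos_cos hx.1.le hx.2, abs_sub_comm] at this
        exact this.le
    _ = ε / (C + 1) * C := by rw [intervalIntegral.integral_const_mul]
    _ ≤ 0 + ε := by
        rw [zero_add, div_mul_eq_mul_div, div_le_iff₀ (by positivity)]
        nlinarith

theorem eq_zero_of_inner_cosMode {f : StateSpace} (h : ∀ n, inner ℝ (cosMode n) f = 0) :
    f = 0 := by
  have h' : ∀ n : ℕ, ∫ x in (0 : ℝ)..Real.pi, Real.cos (n * x) * f x = 0 := fun n => by
    have := h n
    rw [inner_cosMode] at this
    exact (mul_eq_zero.1 this).resolve_left (cosNorm_ne_zero n)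
  rw [Lp.eq_zero_iff_ae_eq_zero]
  have hint : IntegrableOn f (Ioo 0 Real.pi) volume := (Lp.memLp f).integrable (by norm_num)
  have := isOpen_Ioo.ae_eq_zero_of_integral_contDiff_smul_eq_zero (μ := volume)
    (U := Ioo 0 Real.pi) (f := f) hint.locallyIntegrableOn (by
      intro φ hφ _ hsupp
      rw [← setIntegral_eq_integral_of_forall_compl_eq_zero (s := Ioo 0 Real.pi)]
      · simp_rw [smul_eq_mul]
        rw [integral_spaceMeasure fun x => φ x * f x]
        exact integral_continuous_mul_eq_zero (intervalIntegrable_coe f) h' hφ.continuous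
      · intro x hx
        rw [image_eq_zero_of_notMem_tsupport fun h => hx (hsupp h), zero_smul])
  exact (ae_restrict_iff' measurableSet_Ioo).2 this

/-- The Hilbert basis of `L²(0, π)` formed by the eigenfunctions of the Neumann Laplacian. -/
noncomputable def cosBasis : HilbertBasis ℕ ℝ StateSpace :=
  HilbertBasis.mkOfOrthogonalEqBot orthonormal_cosMode (by
    rw [Submodule.eq_bot_iff]
    intro f hf
    refine eq_zero_of_inner_cosMode fun n => ?_
    exact (Submodule.mem_orthogonal _ _).1 hf _ (Submodule.subset_span ⟨n, rfl⟩))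

theorem cosBasis_apply (n : ℕ) : cosBasis n = cosMode n :=
  congrFun (HilbertBasis.coe_mkOfOrthogonalEqBot _ _) n

/-! ### Parseval and convergence by coefficients -/

section HilbertBasis

variable {ι E : Type*} [NormedAddCommGroup E] [InnerProductSpace ℝ E] (e : HilbertBasis ι ℝ E)

theorem hasSum_sq_inner (f : E) : HasSum (fun n => inner ℝ (e n) f ^ 2) (‖f‖ ^ 2) := by
  have := e.hasSum_inner_mul_inner f f
  rw [real_inner_self_eq_norm_sq] at this
  simpa only [real_inner_comm f, ← sq] using this

/-- Dominated convergence for the coefficients with respect to a Hilbert basis. -/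
theorem tendsto_of_inner {α : Type*} {l : Filter α} {F : α → E} {h b : E}
    (hF : ∀ᶠ t in l, ∀ n, |inner ℝ (e n) (F t)| ≤ |inner ℝ (e n) b|)
    (hh : ∀ n, |inner ℝ (e n) h| ≤ |inner ℝ (e n) b|)
    (hlim : ∀ n, Tendsto (fun t => inner ℝ (e n) (F t)) l (𝓝 (inner ℝ (e n) h))) :
    Tendsto F l (𝓝 h) := by
  have key : Tendsto (fun t => ∑' n, inner ℝ (e n) (F t - h) ^ 2) l (𝓝 (∑' _ : ι, (0 : ℝ))) := by
    refine tendsto_tsum_of_dominated_convergence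
      (bound := fun n => 4 * inner ℝ (e n) b ^ 2) ((hasSum_sq_inner e b).summable.mul_left 4) ?_ ?_
    · intro n
      have := ((hlim n).sub_const (inner ℝ (e n) h)).pow 2
      simpa [inner_sub_right] using this
    · filter_upwards [hF] with t ht n
      rw [Real.norm_of_nonneg (sq_nonneg _), inner_sub_right,
        show 4 * inner ℝ (e n) b ^ 2 = (2 * |inner ℝ (e n) b|) ^ 2 by rw [mul_pow, sq_abs]; norm_num]
      refine sq_le_sq' ?_ ?_ <;>
        linarith [abs_le.1 (ht n) |>.1, abs_le.1 (ht n) |>.2, abs_le.1 (hh n) |>.1,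
          abs_le.1 (hh n) |>.2]
  simp_rw [(hasSum_sq_inner e _).tsum_eq, tsum_zero] at key
  rw [tendsto_iff_norm_sub_tendsto_zero]
  have := key.sqrt
  simpa using this

end HilbertBasis

/-! ### The heat semigroup and its generator -/

theorem inner_heat {t : ℝ} (ht : 0 ≤ t) (f : StateSpace) (n : ℕ) :
    inner ℝ (cosMode n) (heat t f) =
      Real.exp (-((n : ℝ) ^ 2 * t)) * inner ℝ (cosMode n) f := by
  have hmem : Memℓp (fun n : ℕ => Real.exp (-((n : ℝ) ^ 2 * t)) * inner ℝ (cosMode n) f) 2 := by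
    refine (lp.memℓp (cosBasis.repr f)).mono' fun n => ?_
    rw [cosBasis.repr_apply_apply, cosBasis_apply, norm_mul, Real.norm_of_nonneg (Real.exp_pos _).le]
    refine mul_le_of_le_one_left (norm_nonneg _) (Real.exp_le_one_iff.2 ?_)
    have : 0 ≤ (n : ℝ) ^ 2 * t := by positivity
    linarith
  have hs := cosBasis.hasSum_repr_symm ⟨_, hmem⟩
  simp only [cosBasis_apply] at hs
  have : heat t f = cosBasis.repr.symm ⟨_, hmem⟩ := hs.tsum_eq
  rw [this, ← cosBasis_apply, ← cosBasis.repr_apply_apply, LinearIsometryEquiv.apply_symm_apply,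
    cosBasis_apply]

theorem ext_inner_cosMode {f h : StateSpace}
    (H : ∀ n, inner ℝ (cosMode n) f = inner ℝ (cosMode n) h) : f = h :=
  sub_eq_zero.1 <| eq_zero_of_inner_cosMode fun n => by rw [inner_sub_right, H, sub_self]

theorem exp_neg_sq_mul_le_one {t : ℝ} (ht : 0 ≤ t) (n : ℕ) :
    Real.exp (-((n : ℝ) ^ 2 * t)) ≤ 1 :=
  Real.exp_le_one_iff.2 (neg_nonpos.2 (by positivity))

theorem abs_inner_heat_le {t : ℝ} (ht : 0 ≤ t) (f : StateSpace) (n : ℕ) :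
    |inner ℝ (cosMode n) (heat t f)| ≤ |inner ℝ (cosMode n) f| := by
  rw [inner_heat ht, abs_mul, abs_of_nonneg (Real.exp_pos _).le]
  exact mul_le_of_le_one_left (abs_nonneg _) (exp_neg_sq_mul_le_one ht n)

theorem norm_heat_le {t : ℝ} (ht : 0 ≤ t) (f : StateSpace) : ‖heat t f‖ ≤ ‖f‖ := by
  refine (sq_le_sq₀ (norm_nonneg _) (norm_nonneg _)).1 ?_
  refine hasSum_le (fun n => ?_) (hasSum_sq_inner cosBasis _) (hasSum_sq_inner cosBasis _)
  rw [cosBasis_apply]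
  exact sq_le_sq.2 (abs_inner_heat_le ht f n)

theorem isLinearMap_heat {t : ℝ} (ht : 0 ≤ t) : IsLinearMap ℝ (heat t) where
  map_add f h := ext_inner_cosMode fun n => by
    simp only [inner_add_right, inner_heat ht]; ring
  map_smul c f := ext_inner_cosMode fun n => by
    simp only [inner_smul_right, inner_heat ht]; ring

theorem isC0Semigroup_heat : IsC0Semigroup heat where
  bounded_linear t ht := (isLinearMap_heat ht).with_bound 1 fun f => by
    rw [one_mul]; exact norm_heat_le ht f
  zero f := ext_inner_cosMode fun n => by simp [inner_heat le_rfl]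
  add s t hs ht f := ext_inner_cosMode fun n => by
    rw [inner_heat (add_nonneg hs ht), inner_heat hs, inner_heat ht, ← mul_assoc, ← Real.exp_add]
    ring_nf
  strongly_continuous f := by
    intro t ht
    refine tendsto_of_inner cosBasis (b := f) ?_ ?_ ?_
    · filter_upwards [self_mem_nhdsWithin] with s hs n
      rw [cosBasis_apply]
      exact abs_inner_heat_le hs f n
    · intro n
      rw [cosBasis_apply]
      exact abs_inner_heat_le ht f n
    · intro n
      rw [cosBasis_apply, inner_heat ht]
      have hc : Continuous fun s : ℝ => Real.exp (-((n : ℝ) ^ 2 * s)) * inner ℝ (cosMode n) f := by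
        fun_prop
      refine (hc.continuousWithinAt (s := Ici 0) (x := t)).congr' ?_
      filter_upwards [self_mem_nhdsWithin] with s hs
      rw [inner_heat hs]

/-- Each coefficient of the difference quotient converges by differentiating `e^{-n² t}` at `0`.
Conversely, `(1 - e^{-λ t}) / t ≤ λ` shows that the coefficients of `h` themselves dominate the
quotients. -/
theorem tendsto_heat_iff (f h : StateSpace) :
    Tendsto (fun t : ℝ => t⁻¹ • (heat t f - f)) (𝓝[>] 0) (𝓝 h) ↔
      ∀ n : ℕ, inner ℝ (cosMode n) h = -(n : ℝ) ^ 2 * inner ℝ (cosMode n) f := by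
  have hcoef : ∀ (n : ℕ), ∀ t : ℝ, 0 < t → inner ℝ (cosMode n) (t⁻¹ • (heat t f - f)) =
      t⁻¹ * (Real.exp (-((n : ℝ) ^ 2 * t)) - 1) * inner ℝ (cosMode n) f := by
    intro n t ht
    rw [inner_smul_right, inner_sub_right, inner_heat ht.le]
    ring
  have hlim : ∀ n : ℕ, Tendsto (fun t : ℝ => inner ℝ (cosMode n) (t⁻¹ • (heat t f - f))) (𝓝[>] 0)
      (𝓝 (-(n : ℝ) ^ 2 * inner ℝ (cosMode n) f)) := by
    intro n
    have hd : HasDerivAt (fun t : ℝ => Real.exp (-((n : ℝ) ^ 2 * t))) (-(n : ℝ) ^ 2) 0 := by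
      have h1 : HasDerivAt (fun t : ℝ => -((n : ℝ) ^ 2 * t)) (-(n : ℝ) ^ 2) 0 := by
        simpa using ((hasDerivAt_id (0 : ℝ)).const_mul ((n : ℝ) ^ 2)).fun_neg
      simpa using h1.exp
    have h2 := (hd.tendsto_slope_zero_right).mul_const (inner ℝ (cosMode n) f)
    refine h2.congr' ?_
    filter_upwards [self_mem_nhdsWithin] with t ht
    rw [hcoef n t ht]
    simp
  constructor
  · intro H n
    refine tendsto_nhds_unique ?_ (hlim n)
    exact ((continuous_const.inner continuous_id).tendsto h).comp H
  · intro H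
    refine tendsto_of_inner cosBasis (b := h) ?_ (fun _ => le_rfl) ?_
    · filter_upwards [self_mem_nhdsWithin] with t (ht : 0 < t) n
      rw [cosBasis_apply, hcoef n t ht, H, abs_mul, abs_mul (-(n : ℝ) ^ 2)]
      refine mul_le_mul_of_nonneg_right ?_ (abs_nonneg _)
      have h1 := exp_neg_sq_mul_le_one ht.le n
      have h2 := Real.add_one_le_exp (-((n : ℝ) ^ 2 * t))
      rw [abs_mul, abs_neg, abs_of_nonneg (sq_nonneg (n : ℝ)), abs_of_pos (inv_pos.2 ht),
        abs_of_nonpos (by linarith), inv_mul_le_iff₀ ht]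
      linarith
    · intro n
      rw [cosBasis_apply, H]
      exact hlim n

/-- Two integrations by parts. The first boundary term vanishes by the Neumann condition on `w`, the
second because `sin (n x)` vanishes at `0` and `π`; no boundary value of `v` is needed. -/
theorem NeumannLaplacian.inner_eq {f h : StateSpace} (H : NeumannLaplacian f h) (n : ℕ) :
    inner ℝ (cosMode n) h = -(n : ℝ) ^ 2 * inner ℝ (cosMode n) f := by
  obtain ⟨v, w, hf, hv, hac, hw, hw0, hwπ⟩ := H
  have hπ : uIcc 0 Real.pi = Icc 0 Real.pi := uIcc_of_le Real.pi_pos.le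
  have h1 : ∫ x in (0 : ℝ)..Real.pi, Real.cos (n * x) * h x =
      ∫ x in (0 : ℝ)..Real.pi, Real.cos (n * x) * deriv w x := by
    rw [← integral_spaceMeasure, ← integral_spaceMeasure]
    refine integral_congr_ae ?_
    filter_upwards [hw] with x hx
    rw [hx.deriv]
  have h2 : ∫ x in (0 : ℝ)..Real.pi, Real.cos (n * x) * f x =
      ∫ x in (0 : ℝ)..Real.pi, Real.cos (n * x) * v x := by
    rw [← integral_spaceMeasure, ← integral_spaceMeasure]
    refine integral_congr_ae ?_
    filter_upwards [hf] with x hx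
    rw [hx]
  have hcos : ∀ x : ℝ, HasDerivAt (fun x : ℝ => Real.cos (n * x)) (-(n * Real.sin (n * x))) x := by
    intro x
    have := ((hasDerivAt_id x).const_mul (n : ℝ)).cos
    simpa [mul_comm] using this
  have hsin : ∀ x : ℝ, HasDerivAt (fun x : ℝ => Real.sin (n * x)) (n * Real.cos (n * x)) x := by
    intro x
    have := ((hasDerivAt_id x).const_mul (n : ℝ)).sin
    simpa [mul_comm] using this
  have hcosac : AbsolutelyContinuousOnInterval (fun x : ℝ => Real.cos (n * x)) 0 Real.pi :=
    ContDiffOn.absolutelyContinuousOnInterval (by fun_prop)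
  have h3 := hcosac.integral_mul_deriv_eq_deriv_mul hac
  have h4 := intervalIntegral.integral_mul_deriv_eq_deriv_mul_of_hasDerivWithinAt
    (a := 0) (b := Real.pi) (u := fun x : ℝ => Real.sin (n * x)) (v := v)
    (u' := fun x => n * Real.cos (n * x)) (v' := w)
    (fun x _ => (hsin x).hasDerivWithinAt) (by rw [hπ]; exact hv)
    (Continuous.intervalIntegrable (by fun_prop) _ _) hac.continuousOn.intervalIntegrable
  rw [inner_cosMode, inner_cosMode, h1, h2, h3, hw0, hwπ]
  simp_rw [fun x => (hcos x).deriv]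
  simp only [Real.sin_nat_mul_pi, mul_zero, Real.sin_zero, zero_mul, sub_zero, zero_sub,
    mul_assoc, neg_mul, intervalIntegral.integral_neg, intervalIntegral.integral_const_mul] at h4 ⊢
  rw [h4]
  ring

theorem neumannLaplacian_of_inner {f h : StateSpace}
    (H : ∀ n : ℕ, inner ℝ (cosMode n) h = -(n : ℝ) ^ 2 * inner ℝ (cosMode n) f) :
    NeumannLaplacian f h := by
  set k : ℝ → ℝ := (Ioo 0 Real.pi).indicator h with hk
  have hint : IntegrableOn h (Ioo 0 Real.pi) volume := (Lp.memLp h).integrable (by norm_num)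
  have hkint : Integrable k := hint.integrable_indicator measurableSet_Ioo
  have hkeq : ∀ᵐ x ∂spaceMeasure, k x = h x := by
    filter_upwards [self_mem_ae_restrict measurableSet_Ioo] with x hx
    exact indicator_of_mem hx _
  set w : ℝ → ℝ := fun x => ∫ y in (0 : ℝ)..x, k y with hw
  have hwc : Continuous w := intervalIntegral.continuous_primitive
    (fun _ _ => hkint.intervalIntegrable) 0
  set v : ℝ → ℝ := fun x => ∫ y in (0 : ℝ)..x, w y with hv
  have hvd : ∀ x, HasDerivAt v (w x) x := fun x =>
    intervalIntegral.integral_hasDerivAt_right (hwc.intervalIntegrable _ _)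
      (hwc.stronglyMeasurableAtFilter _ _) hwc.continuousAt
  have hwac : AbsolutelyContinuousOnInterval w 0 Real.pi :=
    hkint.intervalIntegrable.absolutelyContinuousOnInterval_intervalIntegral left_mem_uIcc
  have hwd : ∀ᵐ x ∂spaceMeasure, HasDerivAt w (h x) x := by
    filter_upwards [hkeq, ae_restrict_of_ae (LocallyIntegrable.ae_hasDerivAt_integral hkint.locallyIntegrable)]
      with x hx hx'
    rw [← hx]
    exact hx' 0
  have hw0 : w 0 = 0 := intervalIntegral.integral_same
  -- Up to normalization `w π` is the zeroth coefficient of `h`, which `H 0` forces to vanish.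
  have hwπ : w Real.pi = 0 := by
    have h0 := H 0
    rw [inner_cosMode] at h0
    have h1 := (mul_eq_zero.1 (h0.trans (by simp))).resolve_left (cosNorm_ne_zero 0)
    rw [← h1]
    change ∫ y in (0 : ℝ)..Real.pi, k y = _
    rw [← integral_spaceMeasure, ← integral_spaceMeasure]
    refine integral_congr_ae ?_
    filter_upwards [hkeq] with x hx
    simp [hx]
  have hvc : Continuous v := continuous_iff_continuousAt.2 fun x => (hvd x).continuousAt
  have hvmem : MemLp v 2 spaceMeasure := by
    obtain ⟨C, hC⟩ := isCompact_Icc.exists_bound_of_continuousOn (s := Icc 0 Real.pi)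
      hvc.continuousOn
    refine MemLp.of_bound hvc.aestronglyMeasurable C ?_
    filter_upwards [self_mem_ae_restrict measurableSet_Ioo] with x hx
    exact hC x (Ioo_subset_Icc_self hx)
  have hN : NeumannLaplacian (hvmem.toLp v) h :=
    ⟨v, w, hvmem.coeFn_toLp, fun x _ => (hvd x).hasDerivWithinAt, hwac, hwd, hw0, hwπ⟩
  -- For `n ≠ 0` the factor `-n²` cancels, so `f` and `v` share all higher coefficients; only the
  -- constant mode, the kernel of the Laplacian, remains to be corrected.
  set a : ℝ := inner ℝ (cosMode 0) (f - hvmem.toLp v) with ha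
  have hf : f = hvmem.toLp v + a • cosMode 0 := by
    refine ext_inner_cosMode fun n => ?_
    rw [inner_add_right, inner_smul_right, orthonormal_iff_ite.1 orthonormal_cosMode]
    split_ifs with hn
    · rw [hn, ha, inner_sub_right]; ring
    · have h1 := hN.inner_eq n
      rw [H n] at h1
      have : (n : ℝ) ≠ 0 := by exact_mod_cast hn
      rw [mul_right_inj' (by simpa using this)] at h1
      rw [h1]; ring
  refine ⟨fun x => v x + a * cosNorm 0, w, ?_,
    fun x _ => ((hvd x).add_const _).hasDerivWithinAt, hwac, hwd, hw0, hwπ⟩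
  rw [hf]
  filter_upwards [Lp.coeFn_add (hvmem.toLp v) (a • cosMode 0), hvmem.coeFn_toLp,
    Lp.coeFn_smul a (cosMode 0), (memLp_cosFun 0).coeFn_toLp] with x h1 h2 h3 h4
  rw [h1, Pi.add_apply, h2, h3, Pi.smul_apply, cosMode, h4, cosFun_eq]
  simp

theorem hasGenerator_heat : HasGenerator heat NeumannLaplacian := fun f h => by
  rw [tendsto_heat_iff]
  exact ⟨fun H => H.inner_eq, neumannLaplacian_of_inner⟩

/-! ### Semilinear equations driven by a contraction semigroup -/

section Abstract

theorem _root_.MeasureTheory.LocallyIntegrable.intervalIntegrable {E : Type*}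
    [NormedAddCommGroup E] {f : ℝ → E} (hf : LocallyIntegrable f volume) {a b : ℝ} :
    IntervalIntegrable f volume a b :=
  (hf.integrableOn_isCompact isCompact_uIcc).intervalIntegrable

theorem _root_.MeasureTheory.LocallyIntegrable.norm {E : Type*}
    [NormedAddCommGroup E] {f : ℝ → E} (hf : LocallyIntegrable f volume) :
    LocallyIntegrable (fun t => ‖f t‖) volume :=
  hf.mono hf.aestronglyMeasurable.norm (Eventually.of_forall fun t => by simp)

variable {E : Type*} [NormedAddCommGroup E]

theorem aestronglyMeasurable_of_countable_pieces {α β κ : Type*} [MeasurableSpace α]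
    [TopologicalSpace β] [Countable κ] [MeasurableSpace κ] [MeasurableSingletonClass κ]
    [TopologicalSpace.PseudoMetrizableSpace β]
    {μ : Measure α} {k : α → κ} (hk : Measurable k) {Φ : κ → α → β}
    (hΦ : ∀ i, AEStronglyMeasurable (Φ i) μ) :
    AEStronglyMeasurable (fun a => Φ (k a) a) μ := by
  have huniv : (⋃ i, k ⁻¹' {i}) = univ := by ext; simp
  rw [← Measure.restrict_univ (μ := μ), ← huniv, aestronglyMeasurable_iUnion_iff]
  intro i
  refine (hΦ i).restrict.congr ?_
  filter_upwards [self_mem_ae_restrict (hk (measurableSet_singleton i))] with a ha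
  rw [show k a = i from ha]

theorem integral_norm_nonneg (f : ℝ → E) {a b : ℝ} (hab : a ≤ b) : 0 ≤ ∫ ξ in a..b, ‖f ξ‖ :=
  intervalIntegral.integral_nonneg hab fun _ _ => norm_nonneg _

/-- A time-dependent nonlinearity that is measurable in time, uniformly Lipschitz in space, and
locally uniformly integrable at the origin. -/
structure IsLipschitzForcing (F : ℝ → E → E) (L : ℝ≥0) : Prop where
  lipschitz : ∀ t, LipschitzWith L (F t)
  aestronglyMeasurable : ∀ v, AEStronglyMeasurable (fun t => F t v) volume
  locallyIntegrable : LocallyIntegrable (fun t => F t 0) volume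
  integral_le : ∃ C, ∀ s t, s ≤ t → ∫ ξ in s..t, ‖F ξ 0‖ ≤ C + (t - s)

namespace IsLipschitzForcing

variable {F : ℝ → E → E} {L : ℝ≥0} (hF : IsLipschitzForcing F L)
include hF

theorem norm_sub_le (t : ℝ) (v w : E) : ‖F t v - F t w‖ ≤ L * ‖v - w‖ :=
  (hF.lipschitz t).norm_sub_le v w

theorem norm_le (t : ℝ) (v : E) : ‖F t v‖ ≤ ‖F t 0‖ + L * ‖v‖ := by
  have h1 := hF.norm_sub_le t v 0
  have h2 := norm_sub_norm_le (F t v) (F t 0)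
  rw [sub_zero] at h1
  linarith

/-- A Carathéodory argument: sampling `u` at the grid points `⌊(n + 1) ξ⌋ / (n + 1)` freezes the
second argument of `F` on countably many pieces, and the samples converge because `u` and `F ξ` are
continuous. -/
theorem aestronglyMeasurable_comp {u : ℝ → E} (hu : Continuous u) :
    AEStronglyMeasurable (fun ξ => F ξ (u ξ)) volume := by
  have hfloor : ∀ ξ : ℝ, Tendsto (fun n : ℕ => (⌊((n : ℝ) + 1) * ξ⌋ : ℝ) / ((n : ℝ) + 1)) atTop
      (𝓝 ξ) := by
    intro ξ
    have h1 : Tendsto (fun n : ℕ => ξ - 1 / ((n : ℝ) + 1)) atTop (𝓝 ξ) := by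
      simpa using tendsto_const_nhds.sub (tendsto_one_div_add_atTop_nhds_zero_nat (𝕜 := ℝ))
    refine tendsto_of_tendsto_of_tendsto_of_le_of_le h1 tendsto_const_nhds (fun n => ?_)
      (fun n => ?_)
    · have h2 : (0 : ℝ) < (n : ℝ) + 1 := by positivity
      have h3 := Int.sub_one_lt_floor (((n : ℝ) + 1) * ξ)
      simp only
      rw [le_div_iff₀ h2, sub_mul, one_div, inv_mul_cancel₀ h2.ne']
      linarith
    · have h2 : (0 : ℝ) < (n : ℝ) + 1 := by positivity
      simp only
      rw [div_le_iff₀ h2]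
      linarith [Int.floor_le (((n : ℝ) + 1) * ξ)]
  refine aestronglyMeasurable_of_tendsto_ae atTop
    (f := fun (n : ℕ) ξ => F ξ (u ((⌊((n : ℝ) + 1) * ξ⌋ : ℝ) / ((n : ℝ) + 1)))) (fun n => ?_)
    (Eventually.of_forall fun ξ => ?_)
  · exact aestronglyMeasurable_of_countable_pieces (k := fun ξ : ℝ => ⌊((n : ℝ) + 1) * ξ⌋)
      (by fun_prop) (Φ := fun (k : ℤ) ξ => F ξ (u ((k : ℝ) / ((n : ℝ) + 1))))
      (fun k => hF.aestronglyMeasurable _)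
  · exact ((hF.lipschitz ξ).continuous.tendsto _).comp ((hu.tendsto ξ).comp (hfloor ξ))

theorem locallyIntegrable_comp {u : ℝ → E} (hu : Continuous u) :
    LocallyIntegrable (fun ξ => F ξ (u ξ)) volume := by
  have h1 : LocallyIntegrable (fun ξ => ‖F ξ 0‖ + L * ‖u ξ‖) volume :=
    hF.locallyIntegrable.norm.add (Continuous.locallyIntegrable (by fun_prop))
  refine h1.mono (hF.aestronglyMeasurable_comp hu) (Eventually.of_forall fun ξ => ?_)
  exact (hF.norm_le ξ (u ξ)).trans (le_abs_self _)

theorem intervalIntegrable_norm_zero (a b : ℝ) :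
    IntervalIntegrable (fun ξ => ‖F ξ 0‖) volume a b :=
  hF.locallyIntegrable.norm.intervalIntegrable

end IsLipschitzForcing

variable [NormedSpace ℝ E]

/-- A strongly continuous semigroup of contractions, extended to negative times as a strongly
continuous family of contractions. -/
structure IsContractionSemigroup (S : ℝ → E →L[ℝ] E) : Prop where
  norm_apply_le : ∀ t v, ‖S t v‖ ≤ ‖v‖
  zero : ∀ v, S 0 v = v
  add : ∀ s t, 0 ≤ s → 0 ≤ t → ∀ v, S (s + t) v = S s (S t v)
  continuous : ∀ v, Continuous fun t => S t v

/-- Continuous functions that solve the integrated equation `u' = Au + F(t, u)` after time `s`. -/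
structure IsMild (S : ℝ → E →L[ℝ] E) (F : ℝ → E → E) (s : ℝ) (x : E) (u : ℝ → E) : Prop where
  continuous : Continuous u
  eq : ∀ t, s ≤ t → u t = S (t - s) x + ∫ ξ in s..t, S (t - ξ) (F ξ (u ξ))

theorem IsContractionSemigroup.continuous_uncurry {S : ℝ → E →L[ℝ] E}
    (hS : IsContractionSemigroup S) : Continuous fun p : ℝ × E => S p.1 p.2 := by
  rw [continuous_iff_continuousAt]
  rintro ⟨t, v⟩
  have h1 : Tendsto (fun p : ℝ × E => S p.1 (p.2 - v)) (𝓝 (t, v)) (𝓝 0) := by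
    refine squeeze_zero_norm (fun p => hS.norm_apply_le p.1 (p.2 - v)) ?_
    have : Continuous fun p : ℝ × E => ‖p.2 - v‖ := by fun_prop
    simpa using this.tendsto (t, v)
  have h2 : Tendsto (fun p : ℝ × E => S p.1 v) (𝓝 (t, v)) (𝓝 (S t v)) :=
    ((hS.continuous v).comp continuous_fst).tendsto (t, v)
  have h3 := h1.add h2
  rw [zero_add] at h3
  refine h3.congr fun p => ?_
  rw [← map_add, sub_add_cancel]

/-! ### Duhamel integrals and Grönwall estimates -/

section Convolution

variable {S : ℝ → E →L[ℝ] E} (hS : IsContractionSemigroup S) {f : ℝ → E}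
  (hf : LocallyIntegrable f volume)
include hS hf

theorem intervalIntegrable_convolution (t a b : ℝ) :
    IntervalIntegrable (fun ξ => S (t - ξ) (f ξ)) volume a b := by
  refine (hf.intervalIntegrable (a := a) (b := b)).mono_fun ?_ ?_
  · have h1 : Continuous fun ξ : ℝ => t - ξ := by fun_prop
    exact hS.continuous_uncurry.comp_aestronglyMeasurable
      (h1.aestronglyMeasurable.prodMk hf.aestronglyMeasurable.restrict)
  · exact Eventually.of_forall fun ξ => hS.norm_apply_le _ _

theorem norm_convolution_le {a b : ℝ} (hab : a ≤ b) (t : ℝ) :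
    ‖∫ ξ in a..b, S (t - ξ) (f ξ)‖ ≤ ∫ ξ in a..b, ‖f ξ‖ :=
  intervalIntegral.norm_integral_le_of_norm_le hab
    (Eventually.of_forall fun _ _ => hS.norm_apply_le _ _) hf.intervalIntegrable.norm

theorem norm_convolution_le_abs (a b t : ℝ) :
    ‖∫ ξ in a..b, S (t - ξ) (f ξ)‖ ≤ |∫ ξ in a..b, ‖f ξ‖| :=
  intervalIntegral.norm_integral_le_abs_of_norm_le
    (Eventually.of_forall fun _ => hS.norm_apply_le _ _) hf.intervalIntegrable.norm

theorem continuous_convolution (s : ℝ) : Continuous fun t => ∫ ξ in s..t, S (t - ξ) (f ξ) := by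
  rw [continuous_iff_continuousAt]
  intro t₀
  -- The two roles of `t` are separated: with the upper limit fixed at `t₀`, dominated convergence
  -- applies; the remaining piece over `t₀..t` is small by absolute continuity of `∫ ‖f‖`.
  have h1 : ContinuousAt (fun t => ∫ ξ in s..t₀, S (t - ξ) (f ξ)) t₀ := by
    refine intervalIntegral.continuousAt_of_dominated_interval (bound := fun ξ => ‖f ξ‖)
      (Eventually.of_forall fun t =>
        (intervalIntegrable_convolution hS hf t s t₀).def'.aestronglyMeasurable)
      (Eventually.of_forall fun t => Eventually.of_forall fun ξ _ => hS.norm_apply_le _ _)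
      hf.intervalIntegrable.norm (Eventually.of_forall fun ξ _ => ?_)
    exact ((hS.continuous (f ξ)).comp (continuous_id.sub continuous_const)).continuousAt
  have h2 : Tendsto (fun t => ∫ ξ in t₀..t, S (t - ξ) (f ξ)) (𝓝 t₀) (𝓝 0) := by
    refine squeeze_zero_norm (fun t => norm_convolution_le_abs hS hf t₀ t t) ?_
    have : Continuous fun t => |∫ ξ in t₀..t, ‖f ξ‖| :=
      (intervalIntegral.continuous_primitive (fun a b => hf.norm.intervalIntegrable) t₀).abs
    simpa using this.tendsto t₀
  have h3 := h1.tendsto.add h2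
  rw [add_zero] at h3
  refine h3.congr fun t => ?_
  exact intervalIntegral.integral_add_adjacent_intervals
    (intervalIntegrable_convolution hS hf t _ _) (intervalIntegrable_convolution hS hf t _ _)

theorem convolution_split [CompleteSpace E] {s ρ t : ℝ} (hsρ : s ≤ ρ) (hρt : ρ ≤ t) :
    ∫ ξ in s..t, S (t - ξ) (f ξ) =
      S (t - ρ) (∫ ξ in s..ρ, S (ρ - ξ) (f ξ)) + ∫ ξ in ρ..t, S (t - ξ) (f ξ) := by
  rw [← intervalIntegral.integral_add_adjacent_intervals
    (intervalIntegrable_convolution hS hf t s ρ) (intervalIntegrable_convolution hS hf t ρ t)]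
  congr 1
  rw [← ContinuousLinearMap.intervalIntegral_comp_comm _
    (intervalIntegrable_convolution hS hf ρ s ρ)]
  refine intervalIntegral.integral_congr fun ξ hξ => ?_
  rw [uIcc_of_le hsρ] at hξ
  rw [← hS.add _ _ (sub_nonneg.2 hρt) (sub_nonneg.2 hξ.2)]
  congr 2
  ring

end Convolution

/-- Grönwall's inequality in integral form. -/
theorem le_mul_exp_of_le_add_integral {φ : ℝ → ℝ} (hφ : Continuous φ) {a K s T : ℝ} (hK : 0 ≤ K)
    (h : ∀ t ∈ Icc s T, φ t ≤ a + K * ∫ ξ in s..t, φ ξ) (hsT : s ≤ T) :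
    φ T ≤ a * Real.exp (K * (T - s)) := by
  -- Integrating factor: `h` makes the derivative of `ψ` nonpositive, so `ψ T ≤ ψ s = a`.
  set ψ : ℝ → ℝ := fun t => Real.exp (-(K * (t - s))) * (a + K * ∫ ξ in s..t, φ ξ) with hψ
  have hd : ∀ t, HasDerivAt ψ (K * Real.exp (-(K * (t - s))) *
      (φ t - (a + K * ∫ ξ in s..t, φ ξ))) t := by
    intro t
    have h1 : HasDerivAt (fun t => ∫ ξ in s..t, φ ξ) (φ t) t :=
      intervalIntegral.integral_hasDerivAt_right (hφ.intervalIntegrable _ _)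
        (hφ.stronglyMeasurableAtFilter _ _) hφ.continuousAt
    have h2 : HasDerivAt (fun t => -(K * (t - s))) (-K) t := by
      simpa using (((hasDerivAt_id t).sub_const s).const_mul K).fun_neg
    refine (h2.exp.mul ((h1.const_mul K).const_add a)).congr_deriv ?_
    ring
  have hanti : AntitoneOn ψ (Icc s T) := by
    refine antitoneOn_of_deriv_nonpos (convex_Icc s T)
      (fun t _ => (hd t).continuousAt.continuousWithinAt)
      (fun t _ => (hd t).differentiableAt.differentiableWithinAt) fun t ht => ?_
    rw [(hd t).deriv]
    refine mul_nonpos_of_nonneg_of_nonpos (by positivity) ?_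
    linarith [h t (interior_subset ht)]
  have h1 := hanti (left_mem_Icc.2 hsT) (right_mem_Icc.2 hsT) hsT
  have h2 : ψ s = a := by simp [hψ]
  rw [h2, hψ] at h1
  have h3 := h T (right_mem_Icc.2 hsT)
  calc φ T ≤ a + K * ∫ ξ in s..T, φ ξ := h3
    _ = (Real.exp (-(K * (T - s))) * (a + K * ∫ ξ in s..T, φ ξ)) * Real.exp (K * (T - s)) := by
      rw [Real.exp_neg]
      field_simp
    _ ≤ a * Real.exp (K * (T - s)) := by gcongr

variable {S : ℝ → E →L[ℝ] E} {F : ℝ → E → E} {L : ℝ≥0}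

theorem IsMild.norm_sub_le (hS : IsContractionSemigroup S) (hF : IsLipschitzForcing F L)
    {s t : ℝ} {x y : E} {u v : ℝ → E} (hu : IsMild S F s x u) (hv : IsMild S F s y v)
    (hst : s ≤ t) : ‖u t - v t‖ ≤ ‖x - y‖ * Real.exp (L * (t - s)) := by
  refine le_mul_exp_of_le_add_integral (φ := fun t => ‖u t - v t‖)
    ((hu.continuous.sub hv.continuous).norm) L.2 (fun τ hτ => ?_) hst
  have hiu := hF.locallyIntegrable_comp hu.continuous
  have hiv := hF.locallyIntegrable_comp hv.continuous
  have h1 : u τ - v τ = S (τ - s) (x - y) +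
      ∫ ξ in s..τ, S (τ - ξ) ((fun ξ => F ξ (u ξ) - F ξ (v ξ)) ξ) := by
    simp only [map_sub]
    rw [intervalIntegral.integral_sub (intervalIntegrable_convolution hS hiu τ s τ)
      (intervalIntegrable_convolution hS hiv τ s τ), hu.eq τ hτ.1, hv.eq τ hτ.1]
    abel
  rw [h1, ← intervalIntegral.integral_const_mul]
  refine (norm_add_le _ _).trans (add_le_add (hS.norm_apply_le _ _) ?_)
  refine (norm_convolution_le hS (hiu.sub hiv) hτ.1 τ).trans ?_
  refine intervalIntegral.integral_mono_on hτ.1 (hiu.sub hiv).norm.intervalIntegrable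
    (Continuous.intervalIntegrable ?_ _ _) fun ξ _ => hF.norm_sub_le ξ _ _
  exact continuous_const.mul (hu.continuous.sub hv.continuous).norm

theorem IsMild.norm_le (hS : IsContractionSemigroup S) (hF : IsLipschitzForcing F L)
    {s t : ℝ} {x : E} {u : ℝ → E} (hu : IsMild S F s x u) (hst : s ≤ t) :
    ‖u t‖ ≤ (‖x‖ + ∫ ξ in s..t, ‖F ξ 0‖) * Real.exp (L * (t - s)) := by
  refine le_mul_exp_of_le_add_integral (φ := fun t => ‖u t‖) hu.continuous.norm L.2
    (fun τ hτ => ?_) hst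
  have hiu := hF.locallyIntegrable_comp hu.continuous
  have h1 : ‖∫ ξ in s..τ, S (τ - ξ) (F ξ (u ξ))‖ ≤ ∫ ξ in s..τ, (‖F ξ 0‖ + L * ‖u ξ‖) := by
    refine (norm_convolution_le hS hiu hτ.1 τ).trans ?_
    refine intervalIntegral.integral_mono_on hτ.1 hiu.norm.intervalIntegrable
      ((hF.intervalIntegrable_norm_zero _ _).add (Continuous.intervalIntegrable ?_ _ _))
      fun ξ _ => hF.norm_le ξ _
    exact continuous_const.mul hu.continuous.norm
  rw [intervalIntegral.integral_add (hF.intervalIntegrable_norm_zero _ _)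
    ((hu.continuous.norm.intervalIntegrable _ _).const_mul _),
    intervalIntegral.integral_const_mul] at h1
  have h2 : ∫ ξ in s..τ, ‖F ξ 0‖ ≤ ∫ ξ in s..t, ‖F ξ 0‖ := by
    rw [← intervalIntegral.integral_add_adjacent_intervals
      (hF.intervalIntegrable_norm_zero s τ) (hF.intervalIntegrable_norm_zero τ t)]
    linarith [integral_norm_nonneg (fun ξ => F ξ 0) hτ.2]
  rw [hu.eq τ hτ.1]
  refine (norm_add_le _ _).trans ?_
  linarith [hS.norm_apply_le (τ - s) x]

/-- The displacement of a mild solution is controlled by the orbit of the semigroup and the size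
of the forcing. -/
theorem IsMild.norm_sub_initial_le (hS : IsContractionSemigroup S) (hF : IsLipschitzForcing F L)
    {s t : ℝ} {x : E} {u : ℝ → E} (hu : IsMild S F s x u) (hst : s ≤ t) :
    ‖u t - x‖ ≤ ‖S (t - s) x - x‖ + ((∫ ξ in s..t, ‖F ξ 0‖) + L * ((t - s) *
      ((‖x‖ + ∫ ξ in s..t, ‖F ξ 0‖) * Real.exp (L * (t - s))))) := by
  have hiu := hF.locallyIntegrable_comp hu.continuous
  have h1 : u t - x = (S (t - s) x - x) + ∫ ξ in s..t, S (t - ξ) (F ξ (u ξ)) := by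
    rw [hu.eq t hst]; abel
  rw [h1]
  refine (norm_add_le _ _).trans (add_le_add_right ?_ _)
  refine (norm_convolution_le hS hiu hst t).trans ?_
  have h2 : ∫ ξ in s..t, ‖F ξ (u ξ)‖ ≤ ∫ ξ in s..t, (‖F ξ 0‖ + L *
      ((‖x‖ + ∫ ξ in s..t, ‖F ξ 0‖) * Real.exp (L * (t - s)))) := by
    refine intervalIntegral.integral_mono_on hst hiu.norm.intervalIntegrable
      ((hF.intervalIntegrable_norm_zero _ _).add intervalIntegrable_const) fun ξ hξ => ?_
    refine (hF.norm_le ξ _).trans ?_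
    gcongr
    refine (hu.norm_le hS hF hξ.1).trans ?_
    have h3 : ∫ ζ in s..ξ, ‖F ζ 0‖ ≤ ∫ ζ in s..t, ‖F ζ 0‖ := by
      rw [← intervalIntegral.integral_add_adjacent_intervals
        (hF.intervalIntegrable_norm_zero s ξ) (hF.intervalIntegrable_norm_zero ξ t)]
      linarith [integral_norm_nonneg (fun ξ => F ξ 0) hξ.2]
    have h4 := integral_norm_nonneg (fun ξ => F ξ 0) hst
    have h5 := hξ.2
    gcongr
  refine h2.trans (le_of_eq ?_)
  rw [intervalIntegral.integral_add (hF.intervalIntegrable_norm_zero _ _) intervalIntegrable_const,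
    intervalIntegral.integral_const, smul_eq_mul]
  ring

theorem IsMild.eq_of_le (hS : IsContractionSemigroup S) (hF : IsLipschitzForcing F L)
    {s t : ℝ} {x : E} {u v : ℝ → E} (hu : IsMild S F s x u) (hv : IsMild S F s x v)
    (hst : s ≤ t) : u t = v t := by
  have := hu.norm_sub_le hS hF hv hst
  rw [sub_self, norm_zero, zero_mul] at this
  exact sub_eq_zero.1 (norm_le_zero_iff.1 this)

theorem IsMild.self (hS : IsContractionSemigroup S) {s : ℝ} {x : E} {u : ℝ → E}
    (hu : IsMild S F s x u) : u s = x := by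
  simpa [hS.zero] using hu.eq s le_rfl

theorem IsMild.restart [CompleteSpace E] (hS : IsContractionSemigroup S)
    (hF : IsLipschitzForcing F L) {s ρ : ℝ} {x : E} {u : ℝ → E} (hu : IsMild S F s x u)
    (hsρ : s ≤ ρ) : IsMild S F ρ (u ρ) u := by
  refine ⟨hu.continuous, fun t ht => ?_⟩
  have h1 : S (t - ρ) (u ρ) = S (t - ρ) (S (ρ - s) x) +
      S (t - ρ) (∫ ξ in s..ρ, S (ρ - ξ) (F ξ (u ξ))) := by
    rw [← map_add, ← hu.eq ρ hsρ]
  rw [hu.eq t (hsρ.trans ht),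
    convolution_split hS (hF.locallyIntegrable_comp hu.continuous) hsρ ht, h1,
    ← hS.add _ _ (sub_nonneg.2 ht) (sub_nonneg.2 hsρ), sub_add_sub_cancel, add_assoc]

end Abstract

/-! ### Global existence by a weighted contraction -/

section Existence

theorem integral_exp_mul_sub_le {c : ℝ} (hc : 0 < c) (s t : ℝ) :
    ∫ ξ in s..t, Real.exp (c * (ξ - s)) ≤ c⁻¹ * Real.exp (c * (t - s)) := by
  have hd : ∀ ξ, HasDerivAt (fun ξ => c⁻¹ * Real.exp (c * (ξ - s))) (Real.exp (c * (ξ - s))) ξ := by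
    intro ξ
    have h1 : HasDerivAt (fun ξ => c * (ξ - s)) c ξ := by
      simpa using ((hasDerivAt_id ξ).sub_const s).const_mul c
    refine (h1.exp.const_mul c⁻¹).congr_deriv ?_
    field_simp
  rw [intervalIntegral.integral_eq_sub_of_hasDerivAt (fun ξ _ => hd ξ)
    (Continuous.intervalIntegrable (by fun_prop) _ _)]
  simp [hc.le]

variable {E : Type*} [NormedAddCommGroup E] [NormedSpace ℝ E]
  {S : ℝ → E →L[ℝ] E} {F : ℝ → E → E} {L : ℝ≥0}

/-- The right-hand side of the mild formulation, for the function `e^{c (ξ - s)} w(ξ)`. -/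
noncomputable def mildMap (S : ℝ → E →L[ℝ] E) (F : ℝ → E → E) (c s : ℝ) (x : E) (w : ℝ → E)
    (t : ℝ) : E :=
  S (t - s) x + ∫ ξ in s..t, S (t - ξ) (F ξ (Real.exp (c * (ξ - s)) • w ξ))

theorem continuous_exp_smul (c s : ℝ) {w : ℝ → E} (hw : Continuous w) :
    Continuous fun ξ => Real.exp (c * (ξ - s)) • w ξ := by
  fun_prop

theorem continuous_mildMap (hS : IsContractionSemigroup S) (hF : IsLipschitzForcing F L)
    (c s : ℝ) (x : E) {w : ℝ → E} (hw : Continuous w) : Continuous (mildMap S F c s x w) :=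
  ((hS.continuous x).comp (continuous_id.sub continuous_const)).add
    (continuous_convolution hS (hF.locallyIntegrable_comp (continuous_exp_smul c s hw)) s)

/-- Integrating the weight `e^{c (ξ - s)}` gains a factor `1 / c`, which beats the Lipschitz
constant as soon as `c ≥ 2 L`, with no restriction on the time interval. -/
theorem norm_mildMap_sub_le (hS : IsContractionSemigroup S) (hF : IsLipschitzForcing F L)
    {c : ℝ} (hc : 0 < c) (hcL : 2 * L ≤ c) {s t : ℝ} (hst : s ≤ t) (x : E) {w w' : ℝ → E}
    (hw : Continuous w) (hw' : Continuous w') {M : ℝ} (hM : ∀ ξ, ‖w ξ - w' ξ‖ ≤ M) :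
    ‖mildMap S F c s x w t - mildMap S F c s x w' t‖ ≤ Real.exp (c * (t - s)) * (2⁻¹ * M) := by
  have hM0 : 0 ≤ M := (norm_nonneg _).trans (hM 0)
  have hi := hF.locallyIntegrable_comp (continuous_exp_smul c s hw)
  have hi' := hF.locallyIntegrable_comp (continuous_exp_smul c s hw')
  have h1 : mildMap S F c s x w t - mildMap S F c s x w' t =
      ∫ ξ in s..t, S (t - ξ) ((fun ξ => F ξ (Real.exp (c * (ξ - s)) • w ξ) -
        F ξ (Real.exp (c * (ξ - s)) • w' ξ)) ξ) := by
    simp only [map_sub]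
    rw [intervalIntegral.integral_sub (intervalIntegrable_convolution hS hi t s t)
      (intervalIntegrable_convolution hS hi' t s t), mildMap, mildMap]
    abel
  rw [h1]
  refine (norm_convolution_le hS (hi.sub hi') hst t).trans ?_
  have h2 : ∫ ξ in s..t, ‖F ξ (Real.exp (c * (ξ - s)) • w ξ) -
      F ξ (Real.exp (c * (ξ - s)) • w' ξ)‖ ≤ ∫ ξ in s..t, L * M * Real.exp (c * (ξ - s)) := by
    refine intervalIntegral.integral_mono_on hst (hi.sub hi').norm.intervalIntegrable
      (Continuous.intervalIntegrable (by fun_prop) _ _) fun ξ _ => ?_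
    refine (hF.norm_sub_le ξ _ _).trans ?_
    rw [← smul_sub, norm_smul, Real.norm_of_nonneg (Real.exp_pos _).le]
    have := hM ξ
    calc (L : ℝ) * (Real.exp (c * (ξ - s)) * ‖w ξ - w' ξ‖)
        ≤ L * (Real.exp (c * (ξ - s)) * M) := by gcongr
      _ = L * M * Real.exp (c * (ξ - s)) := by ring
  refine h2.trans ?_
  rw [intervalIntegral.integral_const_mul]
  calc L * M * ∫ ξ in s..t, Real.exp (c * (ξ - s))
      ≤ L * M * (c⁻¹ * Real.exp (c * (t - s))) := by
        gcongr
        exact integral_exp_mul_sub_le hc s t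
    _ = (L * c⁻¹) * (Real.exp (c * (t - s)) * M) := by ring
    _ ≤ 2⁻¹ * (Real.exp (c * (t - s)) * M) := by
        gcongr
        rw [mul_inv_le_iff₀ hc]
        linarith
    _ = Real.exp (c * (t - s)) * (2⁻¹ * M) := by ring

/-- The at most linear growth of `∫ ‖F ξ 0‖` is absorbed by the exponential weight, so that the
iteration stays among bounded functions. -/
theorem exists_norm_mildMap_zero_le (hS : IsContractionSemigroup S) (hF : IsLipschitzForcing F L)
    {c : ℝ} (hc : 1 ≤ c) (s : ℝ) (x : E) :
    ∃ C, ∀ t, s ≤ t → ‖mildMap S F c s x (fun _ => 0) t‖ ≤ Real.exp (c * (t - s)) * C := by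
  obtain ⟨C, hC⟩ := hF.integral_le
  refine ⟨‖x‖ + |C| + 1, fun t hst => ?_⟩
  have h1 : ‖∫ ξ in s..t, S (t - ξ) (F ξ 0)‖ ≤ |C| + (t - s) :=
    ((norm_convolution_le hS hF.locallyIntegrable hst t).trans (hC s t hst)).trans
      (by linarith [le_abs_self C])
  have h2 : t - s + 1 ≤ Real.exp (c * (t - s)) := by
    have := Real.add_one_le_exp (c * (t - s))
    nlinarith
  have h3 := hS.norm_apply_le (t - s) x
  have h4 : ‖mildMap S F c s x (fun _ => 0) t‖ ≤ ‖x‖ + (|C| + (t - s)) := by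
    simp only [mildMap, smul_zero]
    exact (norm_add_le _ _).trans (add_le_add h3 h1)
  nlinarith [norm_nonneg x, abs_nonneg C]

theorem exists_isMild [CompleteSpace E] (hS : IsContractionSemigroup S)
    (hF : IsLipschitzForcing F L) (s : ℝ) (x : E) : ∃ u, IsMild S F s x u := by
  set c : ℝ := 2 * L + 1 with hcdef
  have hL : (0 : ℝ) ≤ L := L.2
  have hc : 0 < c := by positivity
  have hcL : 2 * (L : ℝ) ≤ c := by linarith
  obtain ⟨C, hC⟩ := exists_norm_mildMap_zero_le hS hF (c := c) (by linarith) s x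
  have hscale : ∀ (t : ℝ) (v : E) (M : ℝ), ‖v‖ ≤ Real.exp (c * (max s t - s)) * M →
      ‖Real.exp (-(c * (max s t - s))) • v‖ ≤ M := by
    intro t v M hv
    rw [norm_smul, Real.norm_of_nonneg (Real.exp_pos _).le, Real.exp_neg,
      inv_mul_le_iff₀ (Real.exp_pos _)]
    exact hv
  have hbound : ∀ (w : BoundedContinuousFunction ℝ E) (t : ℝ),
      ‖Real.exp (-(c * (max s t - s))) • mildMap S F c s x w (max s t)‖ ≤ 2⁻¹ * ‖w‖ + C := by
    intro w t
    refine hscale t _ _ ?_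
    have h1 := norm_mildMap_sub_le hS hF hc hcL (le_max_left s t) x w.continuous
      (continuous_const (y := (0 : E))) (M := ‖w‖) (fun ξ => by
        rw [sub_zero]; exact w.norm_coe_le_norm ξ)
    have h2 := hC (max s t) (le_max_left s t)
    have h3 := norm_sub_norm_le (mildMap S F c s x w (max s t))
      (mildMap S F c s x (fun _ => 0) (max s t))
    linarith
  have hcont : ∀ w : BoundedContinuousFunction ℝ E, Continuous fun t =>
      Real.exp (-(c * (max s t - s))) • mildMap S F c s x w (max s t) := by
    intro w
    have h1 : Continuous fun t : ℝ => max s t := by fun_prop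
    have h2 := (continuous_mildMap hS hF c s x w.continuous).comp h1
    exact Continuous.smul (by fun_prop) h2
  -- The unknown is `w t = e^{-c (t - s)} u t`. Evaluating at `max s t` freezes `Ψ w` before time
  -- `s`, giving a bounded continuous function on all of `ℝ`.
  let Ψ : BoundedContinuousFunction ℝ E → BoundedContinuousFunction ℝ E := fun w =>
    BoundedContinuousFunction.ofNormedAddCommGroup _ (hcont w) _ (hbound w)
  have hΨ : ContractingWith 2⁻¹ Ψ := by
    refine ⟨by rw [inv_lt_one₀] <;> norm_num, LipschitzWith.of_dist_le_mul fun w w' => ?_⟩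
    refine (BoundedContinuousFunction.dist_le (by positivity)).2 fun t => ?_
    change dist (Real.exp (-(c * (max s t - s))) • mildMap S F c s x w (max s t))
      (Real.exp (-(c * (max s t - s))) • mildMap S F c s x w' (max s t)) ≤ _
    rw [dist_eq_norm, ← smul_sub]
    refine hscale t _ _ ?_
    exact norm_mildMap_sub_le hS hF hc hcL (le_max_left s t) x w.continuous w'.continuous
      fun ξ => by rw [← dist_eq_norm]; exact BoundedContinuousFunction.dist_coe_le_dist ξ
  set w := ContractingWith.fixedPoint Ψ hΨ with hw
  have hfix : Ψ w = w := hΨ.fixedPoint_isFixedPt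
  refine ⟨fun ξ => Real.exp (c * (ξ - s)) • w ξ, continuous_exp_smul c s w.continuous,
    fun t ht => ?_⟩
  have h1 : w t = Real.exp (-(c * (max s t - s))) • mildMap S F c s x w (max s t) :=
    (congrArg (fun v : BoundedContinuousFunction ℝ E => v t) hfix).symm
  rw [max_eq_right ht] at h1
  rw [h1, smul_smul, ← Real.exp_add, add_neg_cancel, Real.exp_zero, one_smul, mildMap]

end Existence

/-! ### The evolution family and its joint continuity -/

section Flow

variable {E : Type*} [NormedAddCommGroup E] [NormedSpace ℝ E] [CompleteSpace E]
  {S : ℝ → E →L[ℝ] E} {F : ℝ → E → E} {L : ℝ≥0}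

open scoped Classical in
/-- The evolution family of the equation `u' = Au + F(t, u)`. -/
noncomputable def mildFlow (S : ℝ → E →L[ℝ] E) (F : ℝ → E → E) (t s : ℝ) (x : E) : E :=
  if h : ∃ u, IsMild S F s x u then h.choose t else 0

variable (hS : IsContractionSemigroup S) (hF : IsLipschitzForcing F L)
include hS hF

theorem isMild_mildFlow (s : ℝ) (x : E) : IsMild S F s x fun t => mildFlow S F t s x := by
  have h := exists_isMild hS hF s x
  simp only [mildFlow, dif_pos h]
  exact h.choose_spec

theorem mildFlow_self (s : ℝ) (x : E) : mildFlow S F s s x = x :=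
  (isMild_mildFlow hS hF s x).self hS

theorem IsMild.eq_mildFlow {s t : ℝ} {x : E} {u : ℝ → E} (hu : IsMild S F s x u) (hst : s ≤ t) :
    u t = mildFlow S F t s x :=
  hu.eq_of_le hS hF (isMild_mildFlow hS hF s x) hst

theorem mildFlow_comp {s ρ t : ℝ} (hsρ : s ≤ ρ) (hρt : ρ ≤ t) (x : E) :
    mildFlow S F t s x = mildFlow S F t ρ (mildFlow S F ρ s x) :=
  ((isMild_mildFlow hS hF s x).restart hS hF hsρ).eq_mildFlow hS hF hρt

theorem norm_mildFlow_sub_le {s t : ℝ} (hst : s ≤ t) (x y : E) :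
    ‖mildFlow S F t s x - mildFlow S F t s y‖ ≤ ‖x - y‖ * Real.exp (L * (t - s)) :=
  (isMild_mildFlow hS hF s x).norm_sub_le hS hF (isMild_mildFlow hS hF s y) hst

theorem norm_mildFlow_le {s t : ℝ} (hst : s ≤ t) (x : E) :
    ‖mildFlow S F t s x‖ ≤ (‖x‖ + ∫ ξ in s..t, ‖F ξ 0‖) * Real.exp (L * (t - s)) :=
  (isMild_mildFlow hS hF s x).norm_le hS hF hst

/-- The displacement bound depends on the two times only through `τ - σ` and `∫ ‖F ξ 0‖` over
`σ..τ`, so both endpoints may move. This covers continuity on the diagonal and the variation of the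
initial time. -/
theorem tendsto_mildFlow_initial {α : Type*} {l : Filter α} {σ τ : α → ℝ} {a : ℝ}
    (hσ : Tendsto σ l (𝓝 a)) (hτ : Tendsto τ l (𝓝 a)) (hle : ∀ᶠ i in l, σ i ≤ τ i) (x : E) :
    Tendsto (fun i => mildFlow S F (τ i) (σ i) x) l (𝓝 x) := by
  rw [tendsto_iff_norm_sub_tendsto_zero]
  have hint : Tendsto (fun i => ∫ ξ in σ i..τ i, ‖F ξ 0‖) l (𝓝 0) := by
    have hc : Continuous fun t => ∫ ξ in a..t, ‖F ξ 0‖ :=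
      intervalIntegral.continuous_primitive (fun b c => hF.intervalIntegrable_norm_zero b c) a
    have h1 := ((hc.tendsto a).comp hτ).sub ((hc.tendsto a).comp hσ)
    rw [sub_self] at h1
    refine h1.congr fun i => ?_
    exact intervalIntegral.integral_interval_sub_left (hF.intervalIntegrable_norm_zero _ _)
      (hF.intervalIntegrable_norm_zero _ _)
  have hdiff : Tendsto (fun i => τ i - σ i) l (𝓝 0) := by simpa using hτ.sub hσ
  have hS' : Tendsto (fun i => ‖S (τ i - σ i) x - x‖) l (𝓝 0) := by
    have h1 := ((hS.continuous x).tendsto 0).comp hdiff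
    rw [hS.zero] at h1
    exact tendsto_iff_norm_sub_tendsto_zero.1 h1
  have hexp : Tendsto (fun i => Real.exp (L * (τ i - σ i))) l (𝓝 1) := by
    have h1 : Continuous fun d : ℝ => Real.exp (L * d) := by fun_prop
    simpa [Function.comp_def] using (h1.tendsto 0).comp hdiff
  have hlim := hS'.add (hint.add ((hdiff.mul ((hint.const_add ‖x‖).mul hexp)).const_mul (L : ℝ)))
  simp only [zero_mul, mul_zero, add_zero] at hlim
  refine squeeze_zero' (Eventually.of_forall fun _ => norm_nonneg _) ?_ hlim
  filter_upwards [hle] with i hi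
  exact (isMild_mildFlow hS hF (σ i) x).norm_sub_initial_le hS hF hi

/-- The earlier orbit is followed up to the later initial time, where it is compared with `x`; the
Lipschitz bound carries the difference on to `t`. -/
theorem norm_mildFlow_sub_mildFlow_le {s s' t : ℝ} (hs : s ≤ t) (hs' : s' ≤ t) (x : E) :
    ‖mildFlow S F t s x - mildFlow S F t s' x‖ ≤
      ‖mildFlow S F (max s s') (min s s') x - x‖ * Real.exp (L * (t - max s s')) := by
  rcases le_total s s' with h | h
  · rw [max_eq_right h, min_eq_left h, mildFlow_comp hS hF h hs']
    exact norm_mildFlow_sub_le hS hF hs' _ _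
  · rw [max_eq_left h, min_eq_right h, norm_sub_rev, mildFlow_comp hS hF h hs]
    exact norm_mildFlow_sub_le hS hF hs _ _

theorem tendsto_mildFlow_of_lt {t₀ s₀ : ℝ} (h : s₀ < t₀) (x : E) :
    Tendsto (fun z : ℝ × ℝ => mildFlow S F z.1 z.2 x) (𝓝 (t₀, s₀))
      (𝓝 (mildFlow S F t₀ s₀ x)) := by
  have h1 : Tendsto (fun z : ℝ × ℝ => mildFlow S F z.1 s₀ x) (𝓝 (t₀, s₀))
      (𝓝 (mildFlow S F t₀ s₀ x)) :=
    ((isMild_mildFlow hS hF s₀ x).continuous.comp continuous_fst).tendsto (t₀, s₀)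
  have hmax : Continuous fun z : ℝ × ℝ => max z.2 s₀ := by fun_prop
  have hmin : Continuous fun z : ℝ × ℝ => min z.2 s₀ := by fun_prop
  have h2 : Tendsto (fun z : ℝ × ℝ => mildFlow S F (max z.2 s₀) (min z.2 s₀) x) (𝓝 (t₀, s₀))
      (𝓝 x) :=
    tendsto_mildFlow_initial hS hF (a := s₀) (by simpa using hmin.tendsto (t₀, s₀))
      (by simpa using hmax.tendsto (t₀, s₀)) (Eventually.of_forall fun z => min_le_max) x
  have h3 : Tendsto (fun z : ℝ × ℝ => ‖mildFlow S F (max z.2 s₀) (min z.2 s₀) x - x‖ *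
      Real.exp (L * (z.1 - max z.2 s₀))) (𝓝 (t₀, s₀)) (𝓝 0) := by
    have h4 : Continuous fun z : ℝ × ℝ => Real.exp (L * (z.1 - max z.2 s₀)) := by fun_prop
    simpa using (tendsto_iff_norm_sub_tendsto_zero.1 h2).mul (h4.tendsto (t₀, s₀))
  have h5 : Tendsto (fun z : ℝ × ℝ => mildFlow S F z.1 z.2 x - mildFlow S F z.1 s₀ x)
      (𝓝 (t₀, s₀)) (𝓝 0) := by
    refine squeeze_zero_norm' ?_ h3
    have hev : ∀ᶠ z : ℝ × ℝ in 𝓝 (t₀, s₀), z.2 < z.1 ∧ s₀ < z.1 :=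
      ((isOpen_lt continuous_snd continuous_fst).inter
        (isOpen_lt continuous_const continuous_fst)).mem_nhds ⟨h, h⟩
    filter_upwards [hev] with z hz
    exact norm_mildFlow_sub_mildFlow_le hS hF hz.1.le hz.2.le x
  simpa using h5.add h1

theorem continuousOn_mildFlow :
    ContinuousOn (fun z : ℝ × ℝ × E => mildFlow S F z.1 z.2.1 z.2.2) {z | z.2.1 ≤ z.1} := by
  rintro ⟨t₀, s₀, x₀⟩ (h₀ : s₀ ≤ t₀)
  have hbase : Tendsto (fun z : ℝ × ℝ × E => mildFlow S F z.1 z.2.1 x₀)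
      (𝓝[{z | z.2.1 ≤ z.1}] (t₀, s₀, x₀)) (𝓝 (mildFlow S F t₀ s₀ x₀)) := by
    rcases h₀.lt_or_eq with h | h
    · have hc : Continuous fun z : ℝ × ℝ × E => (z.1, z.2.1) := by fun_prop
      exact (tendsto_mildFlow_of_lt hS hF h x₀).comp
        ((hc.tendsto (t₀, s₀, x₀)).mono_left nhdsWithin_le_nhds)
    · subst h
      rw [mildFlow_self hS hF]
      have hc : Continuous fun z : ℝ × ℝ × E => z.1 := by fun_prop
      have hc' : Continuous fun z : ℝ × ℝ × E => z.2.1 := by fun_prop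
      exact tendsto_mildFlow_initial hS hF
        ((hc'.tendsto (s₀, s₀, x₀)).mono_left nhdsWithin_le_nhds)
        ((hc.tendsto (s₀, s₀, x₀)).mono_left nhdsWithin_le_nhds) self_mem_nhdsWithin x₀
  have hdiff : Tendsto (fun z : ℝ × ℝ × E => mildFlow S F z.1 z.2.1 z.2.2 -
      mildFlow S F z.1 z.2.1 x₀) (𝓝[{z | z.2.1 ≤ z.1}] (t₀, s₀, x₀)) (𝓝 0) := by
    have hc : Continuous fun z : ℝ × ℝ × E => ‖z.2.2 - x₀‖ * Real.exp (L * (z.1 - z.2.1)) := by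
      fun_prop
    have hlim : Tendsto (fun z : ℝ × ℝ × E => ‖z.2.2 - x₀‖ * Real.exp (L * (z.1 - z.2.1)))
        (𝓝[{z | z.2.1 ≤ z.1}] (t₀, s₀, x₀)) (𝓝 0) := by
      simpa using (hc.tendsto (t₀, s₀, x₀)).mono_left nhdsWithin_le_nhds
    refine squeeze_zero_norm' ?_ hlim
    filter_upwards [self_mem_nhdsWithin] with z hz
    exact norm_mildFlow_sub_le hS hF hz _ _
  have := hdiff.add hbase
  simpa [ContinuousWithinAt] using this

end Flow

/-! ### From admissibility to exponential stability -/

theorem one_div_toReal_sub_one_sub_lt_zero {p q : ℝ≥0∞} (hp : 1 ≤ p) (hq : 1 ≤ q)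
    (hpq : (p, q) ≠ (1, ⊤)) : 1 / p.toReal - 1 - 1 / q.toReal < 0 := by
  have hq0 : 0 ≤ 1 / q.toReal := by positivity
  rcases eq_or_ne p ⊤ with rfl | hp_top
  · simp only [ENNReal.toReal_top, div_zero]
    linarith
  have hp1 : 1 ≤ p.toReal := by
    rw [← ENNReal.toReal_one]
    exact ENNReal.toReal_mono hp_top hp
  rcases hp.eq_or_lt with rfl | hp'
  · have hq_top : q ≠ ⊤ := by rintro rfl; exact hpq rfl
    have : 0 < q.toReal := ENNReal.toReal_pos (by rintro rfl; simp at hq) hq_top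
    have : 0 < 1 / q.toReal := by positivity
    simp only [ENNReal.toReal_one]
    linarith
  · have h1 : 1 < p.toReal := by
      rw [← ENNReal.toReal_one]
      exact (ENNReal.toReal_lt_toReal ENNReal.one_ne_top hp_top).2 hp'
    have : 1 / p.toReal < 1 := by rw [div_lt_one] <;> linarith
    linarith

section Stability

variable {X : ℝ → ℝ → StateSpace → StateSpace} (hX : IsContinuousEvolutionFamily X)

/-- The orbit of `x` from time `s`, cut off to the window `[s, s + T]`. -/
noncomputable def windowForcing (X : ℝ → ℝ → StateSpace → StateSpace) (s T : ℝ) (x : StateSpace) :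
    ℝ → StateSpace :=
  (Icc s (s + T)).indicator fun ξ => X ξ s x

include hX

theorem memLp_windowForcing (p : ℝ≥0∞) {s : ℝ} (hs : 0 ≤ s) (T : ℝ) (x : StateSpace) :
    MemLp (windowForcing X s T x) p timeMeasure := by
  have hc : ContinuousOn (fun ξ => X ξ s x) (Icc s (s + T)) := by
    refine hX.continuous.comp (f := fun ξ : ℝ => (ξ, s, x)) (by fun_prop) fun ξ hξ => ?_
    exact ⟨hs, hξ.1⟩
  rw [windowForcing, memLp_indicator_iff_restrict measurableSet_Icc]
  obtain ⟨C, hC⟩ := isCompact_Icc.exists_bound_of_continuousOn hc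
  have hle : timeMeasure.restrict (Icc s (s + T)) ≤ volume.restrict (Icc s (s + T)) :=
    Measure.restrict_mono_measure Measure.restrict_le_self _
  have : MemLp (fun ξ => X ξ s x) p (volume.restrict (Icc s (s + T))) := by
    refine MemLp.of_bound (hc.aestronglyMeasurable measurableSet_Icc) C ?_
    filter_upwards [self_mem_ae_restrict measurableSet_Icc] with ξ hξ using hC ξ hξ
  exact this.mono_measure hle

/-- Within the window `X t ξ (X ξ s x) = X t s x` is independent of `ξ`. Outside it the integrand is
`X t ξ 0`, which need not vanish for a nonlinear family but does not depend on `x`. -/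
theorem intervalIntegrable_windowForcing {s t T : ℝ} (hs : 0 ≤ s) (hT : 0 ≤ T) (ht : s + T ≤ t)
    (x : StateSpace) :
    IntervalIntegrable (fun ξ => X t ξ (windowForcing X s T x ξ)) volume 0 t ∧
    EqOn (fun ξ => X t ξ (windowForcing X s T x ξ))
      (fun ξ => (Icc s (s + T)).indicator (fun _ => X t s x) ξ +
        (Icc s (s + T))ᶜ.indicator (fun ξ => X t ξ 0) ξ) (Icc 0 t) := by
  have ht0 : 0 ≤ t := by linarith
  have heq : EqOn (fun ξ => X t ξ (windowForcing X s T x ξ))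
      (fun ξ => (Icc s (s + T)).indicator (fun _ => X t s x) ξ +
        (Icc s (s + T))ᶜ.indicator (fun ξ => X t ξ 0) ξ) (Icc 0 t) := by
    intro ξ hξ
    by_cases h : ξ ∈ Icc s (s + T)
    · simp only [windowForcing, indicator_of_mem h,
        indicator_of_notMem (notMem_compl_iff.2 h), add_zero]
      exact (hX.comp t ξ s hs h.1 hξ.2 x).symm
    · simp only [windowForcing, indicator_of_notMem h, indicator_of_mem (mem_compl h), zero_add]
  refine ⟨?_, heq⟩
  have hc : ContinuousOn (fun ξ => X t ξ 0) (Icc 0 t) :=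
    hX.continuous.comp (f := fun ξ : ℝ => (t, ξ, (0 : StateSpace))) (by fun_prop)
      fun ξ hξ => ⟨hξ.1, hξ.2⟩
  rw [intervalIntegrable_iff_integrableOn_Icc_of_le ht0]
  refine IntegrableOn.congr_fun ?_ heq.symm measurableSet_Icc
  refine Integrable.add ?_ ?_
  · exact (integrable_const (X t s x)).indicator measurableSet_Icc
  · exact (hc.integrableOn_Icc : Integrable _ _).indicator measurableSet_Icc.compl

theorem green_windowForcing_sub {s t T : ℝ} (hs : 0 ≤ s) (hT : 0 ≤ T) (ht : s + T ≤ t)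
    (x y : StateSpace) :
    green X (windowForcing X s T x) t - green X (windowForcing X s T y) t =
      T • (X t s x - X t s y) := by
  have ht0 : 0 ≤ t := by linarith
  obtain ⟨hix, hex⟩ := intervalIntegrable_windowForcing hX hs hT ht x
  obtain ⟨hiy, hey⟩ := intervalIntegrable_windowForcing hX hs hT ht y
  rw [green, green, ← intervalIntegral.integral_sub hix hiy]
  have h1 : ∫ ξ in (0 : ℝ)..t, (X t ξ (windowForcing X s T x ξ) -
      X t ξ (windowForcing X s T y ξ)) =
      ∫ ξ in (0 : ℝ)..t, (Icc s (s + T)).indicator (fun _ => X t s x - X t s y) ξ := by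
    refine intervalIntegral.integral_congr fun ξ hξ => ?_
    rw [uIcc_of_le ht0] at hξ
    have h2 := hex hξ
    have h3 := hey hξ
    simp only at h2 h3 ⊢
    rw [h2, h3, add_sub_add_right_eq_sub]
    by_cases h : ξ ∈ Icc s (s + T)
    · simp only [indicator_of_mem h]
    · simp only [indicator_of_notMem h, sub_zero]
  rw [h1, intervalIntegral.integral_of_le ht0, ← integral_Icc_eq_integral_Ioc,
    setIntegral_indicator measurableSet_Icc, setIntegral_const,
    inter_eq_self_of_subset_right (Icc_subset_Icc hs ht), measureReal_def, Real.volume_Icc,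
    add_sub_cancel_left, ENNReal.toReal_ofReal hT]

/-- After the first window the difference of Green images is `T` times the difference of orbits,
bounded below on a second window of length `T'`; the inputs differ by at most `B` on the first
window and agree off it. For an infinite exponent `1 / toReal` is `1 / 0 = 0`, the correct power for
a supremum norm. -/
theorem window_estimate {p q : ℝ≥0∞} (hq : 1 ≤ q) {K : ℝ≥0}
    (hK : ∀ f₁ f₂, MemLp f₁ p timeMeasure → MemLp f₂ p timeMeasure →
      eLpNorm (green X f₁ - green X f₂) q timeMeasure ≤ K * eLpNorm (f₁ - f₂) p timeMeasure)
    {s τ T T' : ℝ} (hs : 0 ≤ s) (hT : 0 < T) (hT' : 0 < T') (hτ : s + T ≤ τ) {x y : StateSpace}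
    {b B : ℝ} (hb : 0 ≤ b) (hB : 0 ≤ B)
    (hbD : ∀ t ∈ Icc τ (τ + T'), b ≤ ‖X t s x - X t s y‖)
    (hDB : ∀ t ∈ Icc s (s + T), ‖X t s x - X t s y‖ ≤ B) :
    T * b * T' ^ (1 / q.toReal) ≤ K * (B * T ^ (1 / p.toReal)) := by
  have h1 := hK _ _ (memLp_windowForcing hX p hs T x) (memLp_windowForcing hX p hs T y)
  have hμ : ∀ a c : ℝ, 0 ≤ a → timeMeasure (Icc a (a + c)) = ENNReal.ofReal c := by
    intro a c ha
    rw [Measure.restrict_apply measurableSet_Icc, inter_eq_self_of_subset_left, Real.volume_Icc,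
      add_sub_cancel_left]
    exact fun ξ hξ => ha.trans hξ.1
  have hτ0 : 0 ≤ τ := by linarith
  have hlow : ENNReal.ofReal (T * b * T' ^ (1 / q.toReal)) ≤
      eLpNorm (green X (windowForcing X s T x) - green X (windowForcing X s T y)) q
        timeMeasure := by
    have h2 : eLpNorm ((Icc τ (τ + T')).indicator fun _ => T * b) q timeMeasure =
        ENNReal.ofReal (T * b * T' ^ (1 / q.toReal)) := by
      rw [eLpNorm_indicator_const' measurableSet_Icc (by rw [hμ _ _ hτ0]; simpa using hT')
        (by rintro rfl; simp at hq), hμ _ _ hτ0, Real.enorm_of_nonneg (by positivity),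
        ENNReal.ofReal_mul (mul_nonneg hT.le hb),
        ENNReal.ofReal_rpow_of_nonneg hT'.le (by positivity)]
    rw [← h2]
    refine eLpNorm_mono fun t => ?_
    by_cases h : t ∈ Icc τ (τ + T')
    · rw [indicator_of_mem h, Pi.sub_apply,
        green_windowForcing_sub hX hs hT.le (hτ.trans h.1), norm_smul, norm_mul,
        Real.norm_of_nonneg hb]
      gcongr
      exact hbD t h
    · rw [indicator_of_notMem h, norm_zero]
      exact norm_nonneg _
  have hup : eLpNorm (windowForcing X s T x - windowForcing X s T y) p timeMeasure ≤
      ENNReal.ofReal (B * T ^ (1 / p.toReal)) := by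
    have h2 : eLpNorm ((Icc s (s + T)).indicator fun _ => B) p timeMeasure ≤
        ENNReal.ofReal (B * T ^ (1 / p.toReal)) := by
      refine (eLpNorm_indicator_const_le B p).trans ?_
      rw [hμ _ _ hs, Real.enorm_of_nonneg hB, ENNReal.ofReal_mul hB,
        ENNReal.ofReal_rpow_of_nonneg hT.le (by positivity)]
    refine le_trans (eLpNorm_mono fun t => ?_) h2
    by_cases h : t ∈ Icc s (s + T)
    · rw [indicator_of_mem h, Pi.sub_apply, windowForcing, windowForcing, indicator_of_mem h,
        indicator_of_mem h, Real.norm_of_nonneg hB]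
      exact hDB t h
    · rw [indicator_of_notMem h, Pi.sub_apply, windowForcing, windowForcing, indicator_of_notMem h,
        indicator_of_notMem h, sub_zero, norm_zero, norm_zero]
  have h3 := (hlow.trans h1).trans (mul_le_mul_right hup _)
  rw [← ENNReal.ofReal_coe_nnreal, ← ENNReal.ofReal_mul K.coe_nonneg] at h3
  exact (ENNReal.ofReal_le_ofReal_iff (by positivity)).1 h3

/-- Admissibility implies that the evolution family is uniformly Lipschitz. -/
theorem exists_uniform_lipschitz {p q : ℝ≥0∞} (hq : 1 ≤ q) (hA : Admissible p q X) :
    ∃ C > 0, ∀ t s, 0 ≤ s → s ≤ t → ∀ x y, ‖X t s x - X t s y‖ ≤ C * ‖x - y‖ := by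
  obtain ⟨-, K, -, hK⟩ := hA
  obtain ⟨M, hM, ω, hω, hL⟩ := hX.lipschitz
  set A : ℝ := M * Real.exp (ω * 2) with hAdef
  have hA0 : 0 < A := by positivity
  have hloc : ∀ t s, 0 ≤ s → s ≤ t → t ≤ s + 2 → ∀ x y, ‖X t s x - X t s y‖ ≤ A * ‖x - y‖ := by
    intro t s hs hst ht x y
    refine (hL t s hs hst x y).trans ?_
    have : t - s ≤ 2 := by linarith
    rw [hAdef]
    gcongr
  refine ⟨A + K * A * A, by positivity, fun t s hs hst x y => ?_⟩
  have hKAA : 0 ≤ K * A * A * ‖x - y‖ := by positivity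
  have hAx : 0 ≤ A * ‖x - y‖ := by positivity
  rcases le_total t (s + 2) with ht | ht
  · rw [add_mul]
    linarith [hloc t s hs hst ht x y]
  -- Unit windows `[s, s + 1]` and `[t - 1, t]`, disjoint up to an endpoint because `t ≥ s + 2`. The
  -- value of `b` comes from pushing the difference from `ξ` to `t` at the cost of a factor `A`.
  · have h1 := window_estimate hX (p := p) (q := q) hq hK (s := s) (τ := t - 1) (T := 1)
      (T' := 1) hs one_pos one_pos (by linarith) (x := x) (y := y)
      (b := ‖X t s x - X t s y‖ / A) (B := A * ‖x - y‖) (by positivity) (by positivity)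
      (fun ξ hξ => by
        rw [div_le_iff₀' hA0, hX.comp t ξ s hs (by linarith [hξ.1]) (by linarith [hξ.2]) x,
          hX.comp t ξ s hs (by linarith [hξ.1]) (by linarith [hξ.2]) y]
        exact hloc t ξ (by linarith [hξ.1]) (by linarith [hξ.2]) (by linarith [hξ.1]) _ _)
      (fun ξ hξ => hloc ξ s hs hξ.1 (by linarith [hξ.2]) x y)
    simp only [one_mul, Real.one_rpow, mul_one] at h1
    rw [div_le_iff₀ hA0] at h1
    rw [add_mul]
    linarith

/-- Admissibility implies that the evolution family is a strict contraction over some fixed time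
step. -/
theorem exists_contraction {p q : ℝ≥0∞} (hp : 1 ≤ p) (hq : 1 ≤ q) (hpq : (p, q) ≠ (1, ⊤))
    (hA : Admissible p q X) :
    ∃ R > 0, ∀ s, 0 ≤ s → ∀ x y, ‖X (s + R) s x - X (s + R) s y‖ ≤ 2⁻¹ * ‖x - y‖ := by
  obtain ⟨C, hC, hXC⟩ := exists_uniform_lipschitz hX hq hA
  obtain ⟨-, K, -, hK⟩ := hA
  have hexp := one_div_toReal_sub_one_sub_lt_zero hp hq hpq
  have hlim : Tendsto (fun T : ℝ => K * (C * C) * T ^ (1 / p.toReal - 1 - 1 / q.toReal)) atTop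
      (𝓝 0) := by
    have h1 := (tendsto_rpow_neg_atTop (neg_pos.2 hexp)).const_mul (K * (C * C))
    simpa using h1
  obtain ⟨T, hT1, hT0⟩ :=
    ((hlim.eventually (gt_mem_nhds (show (0 : ℝ) < 2⁻¹ by norm_num))).and
      (eventually_gt_atTop 0)).exists
  refine ⟨2 * T, by positivity, fun s hs x y => ?_⟩
  -- Adjacent windows of equal length: the left side scales as `T ^ (1 + 1/q)`, the right side as `T
  -- ^ (1/p)`. The uniform constant `C` enters once in `b` and once in `B`.
  have h1 := window_estimate hX (p := p) (q := q) hq hK (s := s) (τ := s + T) (T := T)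
      (T' := T) hs hT0 hT0 le_rfl (x := x) (y := y)
      (b := ‖X (s + 2 * T) s x - X (s + 2 * T) s y‖ / C) (B := C * ‖x - y‖) (by positivity)
      (by positivity)
      (fun ξ hξ => by
        have h2 : s ≤ ξ := by linarith [hξ.1]
        have h3 : ξ ≤ s + 2 * T := by linarith [hξ.2]
        rw [div_le_iff₀' hC, hX.comp _ ξ s hs h2 h3 x, hX.comp _ ξ s hs h2 h3 y]
        exact hXC _ ξ (hs.trans h2) h3 _ _)
      (fun ξ hξ => hXC ξ s hs hξ.1 x y)
  set d := ‖X (s + 2 * T) s x - X (s + 2 * T) s y‖ with hd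
  have hpow : T ^ (1 / p.toReal) =
      T * T ^ (1 / q.toReal) * T ^ (1 / p.toReal - 1 - 1 / q.toReal) := by
    rw [Real.rpow_sub hT0, Real.rpow_sub hT0, Real.rpow_one]
    have : T ^ (1 / q.toReal) ≠ 0 := (Real.rpow_pos_of_pos hT0 _).ne'
    field_simp
  have hq0 : 0 < T * T ^ (1 / q.toReal) := mul_pos hT0 (Real.rpow_pos_of_pos hT0 _)
  have h2 : d ≤ K * (C * C) * T ^ (1 / p.toReal - 1 - 1 / q.toReal) * ‖x - y‖ := by
    rw [hpow] at h1
    have h3 : T * T ^ (1 / q.toReal) * (d / C) ≤ T * T ^ (1 / q.toReal) *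
        (K * C * T ^ (1 / p.toReal - 1 - 1 / q.toReal) * ‖x - y‖) := by
      linarith
    have h4 := le_of_mul_le_mul_left h3 hq0
    rw [div_le_iff₀ hC] at h4
    linarith
  exact h2.trans (mul_le_mul_of_nonneg_right hT1.le (norm_nonneg _))

/-- Admissibility implies exponential stability. -/
theorem exists_exponential_stability {p q : ℝ≥0∞} (hp : 1 ≤ p) (hq : 1 ≤ q)
    (hpq : (p, q) ≠ (1, ⊤)) (hA : Admissible p q X) :
    ∃ N > 0, ∃ α > 0, ∀ t s, 0 ≤ s → s ≤ t → ∀ x y,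
      ‖X t s x - X t s y‖ ≤ N * Real.exp (-α * (t - s)) * ‖x - y‖ := by
  obtain ⟨C, hC, hXC⟩ := exists_uniform_lipschitz hX hq hA
  obtain ⟨R, hR, hXR⟩ := exists_contraction hX hp hq hpq hA
  have hiter : ∀ n : ℕ, ∀ s, 0 ≤ s → ∀ x y,
      ‖X (s + n * R) s x - X (s + n * R) s y‖ ≤ 2⁻¹ ^ n * ‖x - y‖ := by
    intro n
    induction n with
    | zero => intro s hs x y; simp [hX.self s hs]
    | succ n ih =>
      intro s hs x y
      have h1 : s ≤ s + n * R := by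
        have : 0 ≤ n * R := by positivity
        linarith
      have h2 : s + (n + 1 : ℕ) * R = (s + n * R) + R := by push_cast; ring
      rw [h2, hX.comp (s + n * R + R) (s + n * R) s hs h1 (by linarith) x,
        hX.comp (s + n * R + R) (s + n * R) s hs h1 (by linarith) y]
      refine (hXR _ (hs.trans h1) _ _).trans ?_
      rw [pow_succ', mul_assoc]
      exact mul_le_mul_of_nonneg_left (ih s hs x y) (by norm_num)
  refine ⟨C * 2, by positivity, Real.log 2 / R, div_pos (Real.log_pos one_lt_two) hR,
    fun t s hs hst x y => ?_⟩
  set n := ⌊(t - s) / R⌋₊ with hn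
  have hn1 : (n : ℝ) * R ≤ t - s := by
    rw [← le_div_iff₀ hR]
    exact Nat.floor_le (div_nonneg (sub_nonneg.2 hst) hR.le)
  have hn2 : (t - s) / R < n + 1 := Nat.lt_floor_add_one _
  have hnR : 0 ≤ n * R := by positivity
  -- The factor `2` pays for the incomplete last step: `2⁻ⁿ = 2 · 2^{-(n + 1)}` and `(t - s) / R < n
  -- + 1`.
  have hpow : (2⁻¹ : ℝ) ^ n ≤ 2 * Real.exp (-(Real.log 2 / R) * (t - s)) := by
    have h1 : (2⁻¹ : ℝ) ^ n = 2 * Real.exp (-(Real.log 2 * (n + 1))) := by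
      rw [mul_add, mul_one, neg_add, Real.exp_add, Real.exp_neg (Real.log 2),
        Real.exp_log two_pos, mul_comm (Real.log 2), ← mul_neg, Real.exp_nat_mul, Real.exp_neg,
        Real.exp_log two_pos]
      ring
    rw [h1]
    have h2 : Real.log 2 * ((t - s) / R) ≤ Real.log 2 * (n + 1) :=
      mul_le_mul_of_nonneg_left hn2.le (Real.log_pos one_lt_two).le
    have h3 : -(Real.log 2 / R) * (t - s) = -(Real.log 2 * ((t - s) / R)) := by ring
    rw [h3]
    gcongr
  have h1 := hXC t (s + n * R) (by linarith) (by linarith) (X (s + n * R) s x) (X (s + n * R) s y)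
  rw [← hX.comp t (s + n * R) s hs (by linarith) (by linarith) x,
    ← hX.comp t (s + n * R) s hs (by linarith) (by linarith) y] at h1
  calc ‖X t s x - X t s y‖ ≤ C * ‖X (s + n * R) s x - X (s + n * R) s y‖ := h1
    _ ≤ C * (2⁻¹ ^ n * ‖x - y‖) := by gcongr; exact hiter n s hs x y
    _ ≤ C * ((2 * Real.exp (-(Real.log 2 / R) * (t - s))) * ‖x - y‖) := by gcongr
    _ = C * 2 * Real.exp (-(Real.log 2 / R) * (t - s)) * ‖x - y‖ := by ring

end Stability

/-! ### `L^r` bounds for perturbed contractions -/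

section Integrability

/-- Jensen's inequality for powers over an interval of length `R`. -/
theorem exists_integral_rpow_le {ρ : ℝ} (hρ : 1 ≤ ρ) {R : ℝ} (hR : 0 < R) :
    ∃ C, 0 ≤ C ∧ ∀ h : ℝ → ℝ, (∀ t, 0 ≤ h t) → LocallyIntegrable h volume →
      LocallyIntegrable (fun t => h t ^ ρ) volume → ∀ t,
        (∫ ξ in t..t + R, h ξ) ^ ρ ≤ C * ∫ ξ in t..t + R, h ξ ^ ρ := by
  refine ⟨R ^ ρ * R⁻¹, by positivity, fun h h0 hi hiρ t => ?_⟩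
  have hle : t ≤ t + R := by linarith
  have hvol : volume.real (Ioc t (t + R)) = R := by
    rw [measureReal_def, Real.volume_Ioc, add_sub_cancel_left, ENNReal.toReal_ofReal hR.le]
  have h1 := (convexOn_rpow hρ).map_set_average_le (μ := volume) (t := Ioc t (t + R)) (f := h)
    (Real.continuous_rpow_const (by linarith)).continuousOn isClosed_Ici
    (by simpa using hR) (by simp) (Eventually.of_forall fun ξ => h0 ξ)
    hi.intervalIntegrable.1 hiρ.intervalIntegrable.1
  rw [setAverage_eq, setAverage_eq, hvol, smul_eq_mul, smul_eq_mul,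
    ← intervalIntegral.integral_of_le hle, ← intervalIntegral.integral_of_le hle] at h1
  have hint : 0 ≤ ∫ ξ in t..t + R, h ξ := intervalIntegral.integral_nonneg hle fun ξ _ => h0 ξ
  rw [Real.mul_rpow (by positivity) hint, Real.inv_rpow hR.le,
    inv_mul_le_iff₀ (Real.rpow_pos_of_pos hR ρ)] at h1
  linarith

/-- A half-contracting recursion with an `L^r` perturbation has solutions in `L^r`. -/
theorem memLp_of_contracting {E : Type*} [NormedAddCommGroup E] {r : ℝ≥0∞} (hr : 1 ≤ r)
    (hr_top : r ≠ ⊤) {u : ℝ → E} (hu : Continuous u) {h : ℝ → ℝ} (h0 : ∀ t, 0 ≤ h t)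
    (hh : MemLp h r volume) {R C : ℝ} (hR : 0 < R) (hC : 0 ≤ C)
    (hstep : ∀ t, 0 ≤ t → ‖u (t + R)‖ ≤ 2⁻¹ * ‖u t‖ + C * ∫ ξ in t..t + R, h ξ) :
    MemLp u r timeMeasure := by
  have hr0 : r ≠ 0 := by rintro rfl; simp at hr
  set ρ := r.toReal with hρdef
  have hρ : 1 ≤ ρ := by
    rw [← ENNReal.toReal_one]
    exact ENNReal.toReal_mono hr_top hr
  have hρ0 : 0 ≤ ρ := by linarith
  have hint : Integrable (fun t => h t ^ ρ) volume := by
    refine (hh.integrable_norm_rpow hr0 hr_top).congr (Eventually.of_forall fun t => ?_)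
    simp only [Real.norm_of_nonneg (h0 t), hρdef]
  obtain ⟨D, hD0, hD⟩ := exists_integral_rpow_le hρ hR
  set B : ℝ := (2 * C) ^ ρ * D with hB
  have hB0 : 0 ≤ B := by positivity
  set Q : ℝ → ℝ := fun t => ∫ ξ in (0 : ℝ)..t, h ξ ^ ρ with hQ
  have hQc : Continuous Q := intervalIntegral.continuous_primitive
    (fun _ _ => hint.intervalIntegrable) 0
  have hρpos : ∀ t, 0 ≤ h t ^ ρ := fun t => Real.rpow_nonneg (h0 t) ρ
  set H := ∫ ξ, h ξ ^ ρ with hH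
  have hQle : ∀ t, 0 ≤ t → Q t ≤ H := by
    intro t ht
    rw [hQ]
    simp only
    rw [intervalIntegral.integral_of_le ht]
    exact setIntegral_le_integral hint (Eventually.of_forall hρpos)
  have hQ0 : ∀ t, 0 ≤ t → 0 ≤ Q t := fun t ht =>
    intervalIntegral.integral_nonneg ht fun ξ _ => hρpos ξ
  have hpoint : ∀ t, 0 ≤ t → ‖u (t + R)‖ ^ ρ ≤
      2⁻¹ * ‖u t‖ ^ ρ + 2⁻¹ * (B * (Q (t + R) - Q t)) := by
    intro t ht
    have hI : 0 ≤ ∫ ξ in t..t + R, h ξ :=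
      intervalIntegral.integral_nonneg (by linarith) fun ξ _ => h0 ξ
    -- Written as a midpoint, the bound passes to `ρ`-th powers by convexity while keeping the
    -- factor `1/2` in front of `‖u t‖ ^ ρ`.
    have h1 : ‖u (t + R)‖ ≤ 2⁻¹ * ‖u t‖ + 2⁻¹ * (2 * C * ∫ ξ in t..t + R, h ξ) := by
      linarith [hstep t ht]
    have h2 := (convexOn_rpow hρ).2 (mem_Ici.2 (norm_nonneg (u t)))
      (mem_Ici.2 (show 0 ≤ 2 * C * ∫ ξ in t..t + R, h ξ by positivity))
      (show (0 : ℝ) ≤ 2⁻¹ by norm_num) (show (0 : ℝ) ≤ 2⁻¹ by norm_num) (by norm_num)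
    simp only [smul_eq_mul] at h2
    refine (Real.rpow_le_rpow (norm_nonneg _) h1 hρ0).trans (h2.trans ?_)
    have h3 := hD h h0 (hh.locallyIntegrable hr) hint.locallyIntegrable t
    have h4 : ∫ ξ in t..t + R, h ξ ^ ρ = Q (t + R) - Q t :=
      (intervalIntegral.integral_interval_sub_left hint.intervalIntegrable
        hint.intervalIntegrable).symm
    rw [h4] at h3
    rw [Real.mul_rpow (by positivity) hI, hB, mul_assoc]
    gcongr
  have huc : Continuous fun t => ‖u t‖ ^ ρ := hu.norm.rpow_const fun _ => Or.inr hρ0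
  set J : ℝ → ℝ := fun x => ∫ t in (0 : ℝ)..x, ‖u t‖ ^ ρ with hJ
  -- Integrating the recursion over `[0, x]` bounds `J (x + R) - J R` by `J x / 2` plus a constant.
  -- Since `J x ≤ J (x + R)` and `J x` is finite, the half is absorbed on the left, uniformly in
  -- `x`.
  have hJle : ∀ x, 0 ≤ x → J x ≤ 2 * (J R + 2⁻¹ * (B * (R * H))) := by
    intro x hx
    have hmono : J x ≤ J (x + R) := by
      have h1 : J (x + R) - J x = ∫ t in x..x + R, ‖u t‖ ^ ρ :=
        intervalIntegral.integral_interval_sub_left (huc.intervalIntegrable _ _)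
          (huc.intervalIntegrable _ _)
      have h2 : 0 ≤ ∫ t in x..x + R, ‖u t‖ ^ ρ :=
        intervalIntegral.integral_nonneg (by linarith) fun t _ => by positivity
      linarith
    have hshift : ∫ t in (0 : ℝ)..x, ‖u (t + R)‖ ^ ρ = J (x + R) - J R := by
      rw [intervalIntegral.integral_comp_add_right (fun t => ‖u t‖ ^ ρ), zero_add]
      exact (intervalIntegral.integral_interval_sub_left (huc.intervalIntegrable _ _)
          (huc.intervalIntegrable _ _)).symm
    -- The shifted integrals of `Q` telescope to the integral over `x..x + R` minus that over
    -- `0..R`; `0 ≤ Q ≤ H` then suffices.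
    have hQint : ∫ t in (0 : ℝ)..x, (Q (t + R) - Q t) ≤ R * H := by
      have hi : ∀ a b, IntervalIntegrable Q volume a b := fun a b => hQc.intervalIntegrable a b
      have hi' : ∀ a b, IntervalIntegrable (fun t => Q (t + R)) volume a b := fun a b =>
        (hQc.comp (continuous_add_const R)).intervalIntegrable a b
      rw [intervalIntegral.integral_sub (hi' _ _) (hi _ _),
        intervalIntegral.integral_comp_add_right Q, zero_add]
      have e1 := intervalIntegral.integral_add_adjacent_intervals (hi 0 R) (hi R (x + R))
      have e2 := intervalIntegral.integral_add_adjacent_intervals (hi 0 x) (hi x (x + R))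
      have e3 : 0 ≤ ∫ t in (0 : ℝ)..R, Q t :=
        intervalIntegral.integral_nonneg hR.le fun t ht => hQ0 t ht.1
      have e4 : ∫ t in x..x + R, Q t ≤ ∫ t in x..x + R, H :=
        intervalIntegral.integral_mono_on (by linarith) (hi _ _) intervalIntegrable_const
          fun t ht => hQle t (hx.trans ht.1)
      rw [intervalIntegral.integral_const, add_sub_cancel_left, smul_eq_mul] at e4
      linarith
    have hle : ∫ t in (0 : ℝ)..x, ‖u (t + R)‖ ^ ρ ≤
        ∫ t in (0 : ℝ)..x, (2⁻¹ * ‖u t‖ ^ ρ + 2⁻¹ * (B * (Q (t + R) - Q t))) := by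
      refine intervalIntegral.integral_mono_on hx ?_ ?_ fun t ht => hpoint t ht.1
      · exact (huc.comp (continuous_add_const R)).intervalIntegrable _ _
      · refine Continuous.intervalIntegrable ?_ _ _
        fun_prop
    rw [intervalIntegral.integral_add
        (Continuous.intervalIntegrable (by fun_prop) _ _)
        (Continuous.intervalIntegrable (by fun_prop) _ _), intervalIntegral.integral_const_mul,
      intervalIntegral.integral_const_mul, intervalIntegral.integral_const_mul, hshift] at hle
    have h5 : B * ∫ t in (0 : ℝ)..x, (Q (t + R) - Q t) ≤ B * (R * H) := by gcongr
    change J (x + R) - J R ≤ 2⁻¹ * J x + _ at hle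
    linarith
  rw [← integrable_norm_rpow_iff hu.aestronglyMeasurable hr0 hr_top]
  refine (integrableOn_Ici_iff_integrableOn_Ioi (μ := volume)).2 ?_
  refine integrableOn_Ioi_of_intervalIntegral_norm_bounded (l := atTop) (b := id)
    (2 * (J R + 2⁻¹ * (B * (R * H)))) 0 (fun x => ?_) tendsto_id ?_
  · exact (huc.integrableOn_Icc (a := 0) (b := x)).mono_set Ioc_subset_Icc_self
  · filter_upwards [eventually_ge_atTop 0] with x hx
    have h1 : ∀ t, ‖‖u t‖ ^ r.toReal‖ = ‖u t‖ ^ ρ := fun t =>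
      Real.norm_of_nonneg (by positivity)
    simp_rw [h1]
    exact hJle x hx

/-- Pointwise `h ≤ h ^ r + 1`, treating `h ≤ 1` and `h ≥ 1` separately. -/
theorem exists_integral_le_add {r : ℝ≥0∞} (hr : 1 ≤ r) (hr_top : r ≠ ⊤) {h : ℝ → ℝ}
    (h0 : ∀ t, 0 ≤ h t) (hh : MemLp h r volume) :
    ∃ C, ∀ s t, s ≤ t → ∫ ξ in s..t, h ξ ≤ C + (t - s) := by
  have hr0 : r ≠ 0 := by rintro rfl; simp at hr
  have hρ : 1 ≤ r.toReal := by
    rw [← ENNReal.toReal_one]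
    exact ENNReal.toReal_mono hr_top hr
  have hint : Integrable (fun t => h t ^ r.toReal) volume := by
    refine (hh.integrable_norm_rpow hr0 hr_top).congr (Eventually.of_forall fun t => ?_)
    simp only [Real.norm_of_nonneg (h0 t)]
  refine ⟨∫ ξ, h ξ ^ r.toReal, fun s t hst => ?_⟩
  have h1 : ∫ ξ in s..t, h ξ ≤ ∫ ξ in s..t, (h ξ ^ r.toReal + 1) := by
    refine intervalIntegral.integral_mono_on hst (hh.locallyIntegrable hr).intervalIntegrable
      (hint.intervalIntegrable.add intervalIntegrable_const) fun ξ _ => ?_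
    rcases le_total (h ξ) 1 with h2 | h2
    · linarith [Real.rpow_nonneg (h0 ξ) r.toReal]
    · have := Real.rpow_le_rpow_of_exponent_le h2 hρ
      rw [Real.rpow_one] at this
      linarith
  rw [intervalIntegral.integral_add hint.intervalIntegrable intervalIntegrable_const,
    intervalIntegral.integral_const, smul_eq_mul, mul_one] at h1
  have h2 : ∫ ξ in s..t, h ξ ^ r.toReal ≤ ∫ ξ, h ξ ^ r.toReal := by
    rw [intervalIntegral.integral_of_le hst]
    exact setIntegral_le_integral hint
      (Eventually.of_forall fun ξ => Real.rpow_nonneg (h0 ξ) _)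
  linarith

end Integrability

/-! ### The superposition operator as a Lipschitz forcing -/

section Superposition

variable {g : ℝ → ℝ → ℝ} {L : ℝ≥0}

theorem coeFn_superposition {t : ℝ} (hL : LipschitzWith L (g t)) (v : StateSpace) :
    superposition g t v =ᵐ[spaceMeasure] fun x => g t (v x) := by
  rw [superposition, dif_pos (memLp_superposition hL v)]
  exact MemLp.coeFn_toLp _

theorem lipschitzWith_superposition {t : ℝ} (hL : LipschitzWith L (g t)) :
    LipschitzWith L (superposition g t) := by
  refine LipschitzWith.of_dist_le_mul fun v w => ?_
  rw [dist_eq_norm, dist_eq_norm]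
  refine Lp.norm_le_mul_norm_of_ae_le_mul ?_
  filter_upwards [coeFn_superposition hL v, coeFn_superposition hL w,
    Lp.coeFn_sub (superposition g t v) (superposition g t w), Lp.coeFn_sub v w] with x h1 h2 h3 h4
  rw [h3, h4, Pi.sub_apply, Pi.sub_apply, h1, h2]
  exact hL.norm_sub_le _ _

theorem norm_superposition_zero_le {t : ℝ} (hL : LipschitzWith L (g t)) :
    ‖superposition g t 0‖ ≤
      (measureUnivNNReal spaceMeasure : ℝ) ^ (2 : ℝ≥0∞).toReal⁻¹ * |g t 0| := by
  refine Lp.norm_le_of_ae_bound (abs_nonneg _) ?_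
  filter_upwards [coeFn_superposition hL 0, Lp.coeFn_zero ℝ 2 spaceMeasure] with x h1 h2
  rw [h1, h2]
  exact le_rfl

theorem coeFn_finsetSum {α ι : Type*} [MeasurableSpace α] {μ : Measure α} {p : ℝ≥0∞}
    (s : Finset ι) (f : ι → Lp ℝ p μ) :
    ((∑ i ∈ s, f i : Lp ℝ p μ) : α → ℝ) =ᵐ[μ] fun x => ∑ i ∈ s, f i x := by
  classical
  induction s using Finset.induction_on with
  | empty =>
    simp only [Finset.sum_empty]
    exact Lp.coeFn_zero ℝ p μ
  | insert a s ha ih =>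
    simp only [Finset.sum_insert ha]
    filter_upwards [Lp.coeFn_add (f a) (∑ i ∈ s, f i), ih] with x h1 h2
    rw [h1, Pi.add_apply, h2]

/-- The level sets of `φ` do not move with `t`: all time dependence sits in the finitely many
scalars `g t c`, whose measurability is assumed. Density of simple functions and continuity in `v`
then give measurability for every `v`. -/
theorem superposition_simpleFunc {t : ℝ} (hL : LipschitzWith L (g t)) {v : StateSpace}
    {φ : SimpleFunc ℝ ℝ} (hφ : φ =ᵐ[spaceMeasure] v) :
    superposition g t v = ∑ c ∈ φ.range, g t c • indicatorConstLp 2 (φ.measurableSet_fiber c)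
      (measure_ne_top spaceMeasure _) (1 : ℝ) := by
  refine Lp.ext ?_
  have hcoe : ∀ᵐ x ∂spaceMeasure, ∀ c ∈ φ.range,
      (g t c • indicatorConstLp 2 (φ.measurableSet_fiber c)
        (measure_ne_top spaceMeasure _) (1 : ℝ) : StateSpace) x =
      g t c * (φ ⁻¹' {c}).indicator (fun _ => 1) x := by
    rw [Filter.eventually_all_finset]
    intro c _
    filter_upwards [Lp.coeFn_smul (g t c) (indicatorConstLp 2 (φ.measurableSet_fiber c)
        (measure_ne_top spaceMeasure _) (1 : ℝ)),
      indicatorConstLp_coeFn (p := 2) (hs := φ.measurableSet_fiber c)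
        (hμs := measure_ne_top spaceMeasure _) (c := (1 : ℝ))] with x h1 h2
    rw [h1, Pi.smul_apply, h2, smul_eq_mul]
  filter_upwards [coeFn_superposition hL v, hφ, hcoe, coeFn_finsetSum φ.range fun c =>
    (g t c • indicatorConstLp 2 (φ.measurableSet_fiber c)
        (measure_ne_top spaceMeasure _) (1 : ℝ) : StateSpace)] with x h1 h2 h3 h4
  rw [h1, h4, Finset.sum_congr rfl h3, ← h2,
    Finset.sum_eq_single_of_mem (φ x) (φ.mem_range_self x)]
  · simp
  · intro c _ hc
    rw [indicator_of_notMem, mul_zero]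
    exact fun h => hc h.symm

theorem aestronglyMeasurable_superposition (hg_lip : ∀ t, 0 ≤ t → LipschitzWith L (g t))
    (hg_meas : ∀ y, AEStronglyMeasurable (fun t => g t y) timeMeasure) (v : StateSpace) :
    AEStronglyMeasurable (fun t => superposition g t v) timeMeasure := by
  have hdense : v ∈ closure (range
      (Subtype.val : Lp.simpleFunc ℝ 2 spaceMeasure → StateSpace)) :=
    Lp.simpleFunc.denseRange (by norm_num) v
  obtain ⟨w, hw, hlim⟩ := mem_closure_iff_seq_limit.1 hdense
  refine aestronglyMeasurable_of_tendsto_ae atTop (f := fun n t => superposition g t (w n))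
    (fun n => ?_) ?_
  · obtain ⟨φ, hφ⟩ := hw n
    have h1 := Lp.simpleFunc.toSimpleFunc_eq_toFun φ
    rw [hφ] at h1
    have h2 : AEStronglyMeasurable (fun t => ∑ c ∈ (Lp.simpleFunc.toSimpleFunc φ).range,
        g t c • (indicatorConstLp 2 ((Lp.simpleFunc.toSimpleFunc φ).measurableSet_fiber c)
          (measure_ne_top spaceMeasure _) (1 : ℝ) : StateSpace)) timeMeasure := by
      refine Finset.aestronglyMeasurable_fun_sum _ fun c _ => ?_
      exact (hg_meas c).smul_const _
    refine h2.congr ?_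
    filter_upwards [self_mem_ae_restrict measurableSet_Ici] with t ht
    exact (superposition_simpleFunc (hg_lip t ht) h1).symm
  · filter_upwards [self_mem_ae_restrict measurableSet_Ici] with t ht
    exact ((lipschitzWith_superposition (hg_lip t ht)).continuous.tendsto v).comp hlim

/-- The superposition operator, extended by `0` to negative times. -/
noncomputable def forcing (g : ℝ → ℝ → ℝ) (t : ℝ) (v : StateSpace) : StateSpace :=
  (Ici (0 : ℝ)).indicator (fun t => superposition g t v) t

theorem forcing_of_nonneg {t : ℝ} (ht : 0 ≤ t) (v : StateSpace) :
    forcing g t v = superposition g t v := indicator_of_mem (mem_Ici.2 ht) _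

variable (hg_lip : ∀ t, 0 ≤ t → LipschitzWith L (g t))
  (hg_meas : ∀ y, AEStronglyMeasurable (fun t => g t y) timeMeasure)
include hg_lip hg_meas

theorem aestronglyMeasurable_forcing (v : StateSpace) :
    AEStronglyMeasurable (fun t => forcing g t v) volume :=
  (aestronglyMeasurable_indicator_iff measurableSet_Ici).2
    (aestronglyMeasurable_superposition hg_lip hg_meas v)

theorem memLp_norm_forcing_zero {r : ℝ≥0∞} (hg_zero : MemLp (fun t => g t 0) r timeMeasure) :
    MemLp (fun t => ‖forcing g t 0‖) r volume := by
  refine MemLp.norm ?_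
  refine (memLp_indicator_iff_restrict measurableSet_Ici).2 ?_
  refine hg_zero.of_le_mul (aestronglyMeasurable_superposition hg_lip hg_meas 0)
    (c := (measureUnivNNReal spaceMeasure : ℝ) ^ (2 : ℝ≥0∞).toReal⁻¹) ?_
  filter_upwards [self_mem_ae_restrict measurableSet_Ici] with t ht
  exact norm_superposition_zero_le (hg_lip t ht)

theorem isLipschitzForcing_forcing {r : ℝ≥0∞} (hr : 1 ≤ r) (hr_top : r ≠ ⊤)
    (hg_zero : MemLp (fun t => g t 0) r timeMeasure) : IsLipschitzForcing (forcing g) L where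
  lipschitz t := by
    rcases le_or_gt 0 t with ht | ht
    · simpa only [funext (forcing_of_nonneg ht)] using lipschitzWith_superposition (hg_lip t ht)
    · have : forcing g t = fun _ => 0 :=
        funext fun v => indicator_of_notMem (notMem_Ici.2 ht) _
      rw [this]
      exact LipschitzWith.const' 0
  aestronglyMeasurable := aestronglyMeasurable_forcing hg_lip hg_meas
  locallyIntegrable := by
    have h1 := (memLp_norm_forcing_zero hg_lip hg_meas hg_zero).locallyIntegrable hr
    exact h1.mono (aestronglyMeasurable_forcing hg_lip hg_meas 0)
      (Eventually.of_forall fun t => by simp)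
  integral_le := exists_integral_le_add hr hr_top (fun _ => norm_nonneg _)
    (memLp_norm_forcing_zero hg_lip hg_meas hg_zero)

end Superposition

/-! ### Transfer between the abstract and the concrete equation -/

section HeatOperator

/-- The heat semigroup as a family of bounded operators, frozen at negative times. -/
noncomputable def heatOp (t : ℝ) : StateSpace →L[ℝ] StateSpace :=
  (isC0Semigroup_heat.bounded_linear (max t 0) (le_max_right t 0)).toContinuousLinearMap

theorem heatOp_apply (t : ℝ) (f : StateSpace) : heatOp t f = heat (max t 0) f := rfl

theorem heatOp_of_nonneg {t : ℝ} (ht : 0 ≤ t) (f : StateSpace) : heatOp t f = heat t f := by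
  rw [heatOp_apply, max_eq_left ht]

theorem isContractionSemigroup_heatOp : IsContractionSemigroup heatOp where
  norm_apply_le t v := norm_heat_le (le_max_right t 0) v
  zero v := by rw [heatOp_of_nonneg le_rfl, isC0Semigroup_heat.zero]
  add s t hs ht v := by
    rw [heatOp_of_nonneg hs, heatOp_of_nonneg ht, heatOp_of_nonneg (add_nonneg hs ht),
      isC0Semigroup_heat.add s t hs ht]
  continuous v := by
    have h1 : Continuous fun t : ℝ => max t 0 := by fun_prop
    exact (isC0Semigroup_heat.strongly_continuous v).comp_continuous h1
      fun t => le_max_right t 0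

theorem integral_heatOp_forcing (g : ℝ → ℝ → ℝ) {s t : ℝ} (hs : 0 ≤ s) (hst : s ≤ t)
    (v : ℝ → StateSpace) :
    ∫ ξ in s..t, heatOp (t - ξ) (forcing g ξ (v ξ)) =
      ∫ ξ in s..t, heat (t - ξ) (superposition g ξ (v ξ)) := by
  refine intervalIntegral.integral_congr fun ξ hξ => ?_
  rw [uIcc_of_le hst] at hξ
  rw [heatOp_of_nonneg (sub_nonneg.2 hξ.2), forcing_of_nonneg (hs.trans hξ.1)]

theorem IsMild.isMildSolution {g : ℝ → ℝ → ℝ} {s : ℝ} (hs : 0 ≤ s) {x : StateSpace}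
    {v : ℝ → StateSpace} (hv : IsMild heatOp (forcing g) s x v) : IsMildSolution g s x v := by
  refine ⟨hv.continuous.continuousOn, fun t ht => ?_⟩
  rw [hv.eq t ht, heatOp_of_nonneg (sub_nonneg.2 ht), integral_heatOp_forcing g hs ht]

/-- The abstract notion asks for continuity on all of `ℝ`, so the solution is held constant before
time `s`; the integral equation only sees times after `s`. -/
theorem IsMildSolution.isMild {g : ℝ → ℝ → ℝ} {s : ℝ} (hs : 0 ≤ s) {x : StateSpace}
    {v : ℝ → StateSpace} (hv : IsMildSolution g s x v) :
    IsMild heatOp (forcing g) s x fun t => v (max s t) := by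
  have h1 : Continuous fun t : ℝ => max s t := by fun_prop
  refine ⟨hv.1.comp_continuous h1 fun t => le_max_left s t, fun t ht => ?_⟩
  rw [integral_heatOp_forcing g hs ht, heatOp_of_nonneg (sub_nonneg.2 ht), max_eq_right ht,
    hv.2 t ht]
  congr 1
  refine intervalIntegral.integral_congr fun ξ hξ => ?_
  rw [uIcc_of_le ht] at hξ
  rw [max_eq_right hξ.1]

end HeatOperator

end NeumannHeat

/-! ### The main theorem -/

open NeumannHeat in
theorem theorem3p3 (r : ℝ≥0∞) (hr : 1 ≤ r) (hr_top : r ≠ ⊤)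
    (g : ℝ → ℝ → ℝ) (L : ℝ≥0)
    (hg_lip : ∀ t, 0 ≤ t → LipschitzWith L (g t))
    (hg_meas : ∀ y, AEStronglyMeasurable (fun t => g t y) timeMeasure)
    (hg_zero : MemLp (fun t => g t 0) r timeMeasure) :
    IsC0Semigroup heat ∧ HasGenerator heat NeumannLaplacian ∧
    ∃ X : ℝ → ℝ → StateSpace → StateSpace,
      IsContinuousEvolutionFamily X ∧ Generates g X ∧
      ∀ p q : ℝ≥0∞, 1 ≤ p → 1 ≤ q → (p, q) ≠ (1, ⊤) → Admissible p q X →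
        ∃ u : ℝ → StateSpace,
          (∃ x₀, IsMildSolution g 0 x₀ u) ∧ MemLp u r timeMeasure ∧
          ∃ N > 0, ∃ α > 0, ∀ s, 0 ≤ s → ∀ x v, IsMildSolution g s x v →
            ∀ t, s ≤ t → ‖v t - u t‖ ≤ N * Real.exp (-α * (t - s)) * ‖x - u s‖ := by
  have hS := isContractionSemigroup_heatOp
  have hF := isLipschitzForcing_forcing hg_lip hg_meas hr hr_top hg_zero
  have hX : IsContinuousEvolutionFamily (mildFlow heatOp (forcing g)) :=
    { self := fun t _ x => mildFlow_self hS hF t x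
      comp := fun t ρ s _ hsρ hρt x => mildFlow_comp hS hF hsρ hρt x
      lipschitz := by
        have hL : (0 : ℝ) ≤ L := L.coe_nonneg
        refine ⟨1, one_pos, L + 1, by positivity, fun t s _ hst x y => ?_⟩
        refine (norm_mildFlow_sub_le hS hF hst x y).trans ?_
        rw [one_mul, mul_comm]
        have : 0 ≤ t - s := sub_nonneg.2 hst
        gcongr
        linarith
      continuous := (continuousOn_mildFlow hS hF).mono fun z hz => hz.2 }
  have hgen : Generates g (mildFlow heatOp (forcing g)) := fun s hs x =>
    ⟨(isMild_mildFlow hS hF s x).isMildSolution hs, fun v hv t ht => by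
      have := (hv.isMild hs).eq_mildFlow hS hF ht
      rwa [max_eq_right ht] at this⟩
  refine ⟨isC0Semigroup_heat, hasGenerator_heat, _, hX, hgen, fun p q hp hq hpq hA => ?_⟩
  set X := mildFlow heatOp (forcing g) with hXdef
  -- The orbit of `0` is convenient because the comparison orbit `X (t + R) t 0` below is bounded by
  -- the forcing at the origin alone, with Grönwall constant `e^{L R}`.
  refine ⟨fun t => X t 0 0, ⟨0, (hgen 0 le_rfl 0).1⟩, ?_, ?_⟩
  · obtain ⟨R, hR, hXR⟩ := exists_contraction hX hp hq hpq hA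
    refine memLp_of_contracting hr hr_top (isMild_mildFlow hS hF 0 0).continuous
      (fun _ => norm_nonneg _) (memLp_norm_forcing_zero hg_lip hg_meas hg_zero) hR
      (C := Real.exp (L * R)) (Real.exp_pos _).le fun t ht => ?_
    have htR : t ≤ t + R := by linarith
    have h1 := hXR t ht (X t 0 0) 0
    have h2 := norm_mildFlow_le hS hF htR 0
    rw [← hX.comp (t + R) t 0 le_rfl ht htR, sub_zero] at h1
    rw [norm_zero, zero_add, add_sub_cancel_left, mul_comm, ← hXdef] at h2
    have h3 := norm_sub_norm_le (X (t + R) 0 0) (X (t + R) t 0)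
    linarith
  · obtain ⟨N, hN, α, hα, hstab⟩ := exists_exponential_stability hX hp hq hpq hA
    refine ⟨N, hN, α, hα, fun s hs x v hv t hst => ?_⟩
    beta_reduce
    rw [(hgen s hs x).2 v hv t hst, hX.comp t s 0 le_rfl hs hst]
    exact hstab t s hs hst x _
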